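/- Let $M$ be a complex manifold of complex dimension $n$, with complex structure $J$, and let $g$ be an indefinite Hermitian metric on $M$ of index $2s$, $0<s<n$ (a $C^\infty$ semi-Riemannian metric of index $2s$ with $g(JX,JY)=g(X,Y)$), with Levi-Civita connection $\nabla$. Assume that $g$ is locally conformal Kähler: every point of $M$ has an open neighbourhood $U$ with a $C^\infty$ function $f:U\to\mathbb R$ such that $e^{-f}g$ is an indefinite Kähler metric on $U$ (i.e. $J$ is parallel for its Levi-Civita connection). Let $\omega$ be the Lee form (the global $1$-form which equals $df$ on each such $U$), $B$ the Lee field ($g(X,B)=\omega(X)$ for all $X$), $A=-JB$ the anti-Lee field and $Z=B+iA$. Assume that $\nabla\omega=0$ and that $B$ is lightlike, i.e. $B$ vanishes nowhere and $g(B,B)=0$. Let $\mathcal F$ be the foliation of $M$ given by $\omega=0$ (the first canonical foliation), and let $\mathcal F_0$ be the foliation with tangent bundle $P=\mathbb RA\oplus\mathbb RB$ (the second canonical foliation). Put $T_{1,0}(\mathcal F)=T^{1,0}(M)\cap[T(\mathcal F)\otimes\mathbb C]$ and $H(\mathcal F)=\mathrm{Re}\{T_{1,0}(\mathcal F)\oplus\overline{T_{1,0}(\mathcal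 F)}\}$; their restrictions to a leaf $L$ of $\mathcal F$ are the CR structure and the Levi distribution $H(L)$ of $L$. The Levi form of the leaves is $\mathcal L(V,\overline W)=i\,\pi[V,\overline W]$ for $V,W\in T_{1,0}(\mathcal F)$, where $\pi:T(\mathcal F)\to T(\mathcal F)/H(\mathcal F)$ is the projection. A leaf is Levi-flat if its Levi form vanishes identically; its Levi foliation is then the foliation of $L$ with tangent bundle $H(L)$. A holomorphic foliation of $M$ is an involutive holomorphic subbundle of the holomorphic tangent bundle (identified with $(T(M),J)$); it extends the Levi foliation of $L$ if its tangent bundle coincides with $H(L)$ along $L$. Then: (1) The Levi form of each leaf of $\mathcal F$ is degenerate at every point: $Z$ is a nowhere vanishing section of $T_{1,0}(\mathcal F)$ with $\mathcal L(Z,\overline W)=0$ for all $W\in T_{1,0}(\mathcal F)$; in particular $\mathcal L(Z,\overline Z)=0$. (2) $P$ is involutive and $\mathcal F_0$ is a subfoliation of $\mathcal F$: $P\subseteq T(\mathcal F)$, and each leaf of $\mathcal F_0$ is contained in a leaf of $\mathcal F$. (3) If $n=2$, then each leaf of $\mathcal F$ is Levi-flat, and $\mathcal F_0$ is a holomorphic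 foliation of $M$ which extends the Levi foliation of every leaf of $\mathcal F$. It is the only holomorphic foliation of $M$ that extends the Levi foliations of all leaves of $\mathcal F$; and if $M$ is connected, then for each single leaf $L$ of $\mathcal F$ it is the only holomorphic foliation of $M$ that extends the Levi foliation of $L$. -/

import Mathlib

open Set
open scoped Manifold ContDiff Topology

/-- The real manifold underlying a complex manifold. -/
instance IndefLCK.realManifold {E : Type*} [NormedAddCommGroup E] [NormedSpace ℂ E]
    {M : Type*} [TopologicalSpace M] [ChartedSpace E M] [IsManifold 𝓘(ℂ, E) ω M] :
    IsManifold 𝓘(ℝ, E) ω M := by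
  apply isManifold_of_contDiffOn
  intro e e' he he'
  have h := (contDiffGroupoid ω 𝓘(ℂ, E)).compatible he he'
  rw [contDiffGroupoid, mem_groupoid_of_pregroupoid] at h
  exact ContDiffOn.restrict_scalars ℝ h.1

namespace IndefLCK

noncomputable section

section Basic

variable (E : Type*) [NormedAddCommGroup E] [NormedSpace ℂ E]
  {M : Type*} [TopologicalSpace M] [ChartedSpace E M]

/-- The real tangent space `T_x(M)` of a complex manifold modelled on `E`. -/
abbrev RT (x : M) : Type _ := TangentSpace 𝓘(ℝ, E) x

variable (M)

/-- Real vector fields (with no regularity). -/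
abbrev VField : Type _ := ∀ x : M, RT E x

/-- Real `1`-forms (with no regularity). -/
abbrev Form1 : Type _ := ∀ x : M, RT E x →L[ℝ] ℝ

/-- Fields of real bilinear forms on the tangent spaces (with no regularity). -/
abbrev BilinField : Type _ := ∀ x : M, RT E x →L[ℝ] RT E x →L[ℝ] ℝ

/-- Sections of the complexified tangent bundle `T(M) ⊗ ℂ` (with no regularity): the pair
`(a, b)` stands for `a + i b`. -/
abbrev CxField : Type _ := ∀ x : M, RT E x × RT E x

/-- Fields of real subspaces of the tangent spaces (with no regularity). -/
abbrev Distribution : Type _ := ∀ x : M, Submodule ℝ (RT E x)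

end Basic

variable {E : Type*} [NormedAddCommGroup E] [NormedSpace ℂ E]
  {M : Type*} [TopologicalSpace M] [ChartedSpace E M]

/-- The complex structure `J` of the complex manifold: multiplication by `i` in a holomorphic
chart (`TangentSpace` at `x` is the model space `E`, read in the preferred chart at `x`). -/
def cxJ (x : M) : RT E x →L[ℝ] RT E x :=
  (Complex.I • ContinuousLinearMap.id ℝ E : E →L[ℝ] E)

/-! ### Smoothness -/

section Smooth

variable [IsManifold 𝓘(ℂ, E) ω M]

/-- The vector field `X` is differentiable at `x`. -/
def DiffAt (X : VField E M) (x : M) : Prop :=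
  MDifferentiableAt 𝓘(ℝ, E) (𝓘(ℝ, E).prod 𝓘(ℝ, E))
    (fun y => (⟨y, X y⟩ : TangentBundle 𝓘(ℝ, E) M)) x

/-- The vector field `X` is `C^∞` at `x`. -/
def SmoothAt (X : VField E M) (x : M) : Prop :=
  ContMDiffAt 𝓘(ℝ, E) (𝓘(ℝ, E).prod 𝓘(ℝ, E)) ∞
    (fun y => (⟨y, X y⟩ : TangentBundle 𝓘(ℝ, E) M)) x

/-- The field of bilinear forms `g` is `C^∞`. -/
def SmoothBilin (g : BilinField E M) : Prop :=
  ContMDiff 𝓘(ℝ, E) (𝓘(ℝ, E).prod 𝓘(ℝ, E →L[ℝ] E →L[ℝ] ℝ)) ∞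
    (fun y => Bundle.TotalSpace.mk' (E →L[ℝ] E →L[ℝ] ℝ)
      (E := fun y : M => RT E y →L[ℝ] RT E y →L[ℝ] ℝ) y (g y))

end Smooth

/-! ### Indefinite Hermitian metrics -/

/-- The symmetric bilinear form `b` is nondegenerate of index `ν`: the maximal dimension of a
subspace on which it is negative definite is `ν`. -/
def HasIndex {V : Type*} [AddCommGroup V] [Module ℝ V] (b : V → V → ℝ) (ν : ℕ) : Prop :=
  (∃ W : Submodule ℝ V, Module.finrank ℝ W = ν ∧ ∀ w ∈ W, w ≠ 0 → b w w < 0) ∧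
    ∀ W : Submodule ℝ V, (∀ w ∈ W, w ≠ 0 → b w w < 0) → Module.finrank ℝ W ≤ ν

/-- `g` is an indefinite Hermitian metric of index `ν` on the complex manifold `M`: a
semi-Riemannian metric of index `ν` for which `J` is an isometry of each tangent space. -/
structure IsIndefHermitian [IsManifold 𝓘(ℂ, E) ω M] (g : BilinField E M) (ν : ℕ) : Prop where
  smooth : SmoothBilin g
  symm : ∀ (x : M) (v w : RT E x), g x v w = g x w v
  nondegenerate : ∀ (x : M) (v : RT E x), (∀ w : RT E x, g x v w = 0) → v = 0
  index : ∀ x : M, HasIndex (fun v w : RT E x => g x v w) ν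
  hermitian : ∀ (x : M) (v w : RT E x), g x (cxJ x v) (cxJ x w) = g x v w

/-! ### The Levi-Civita connection -/

/-- The derivative at `x` of the function `f` in the direction `v`. -/
def dirDeriv (f : M → ℝ) (x : M) (v : RT E x) : ℝ :=
  (mfderiv 𝓘(ℝ, E) 𝓘(ℝ, ℝ) f x v : ℝ)

/-- The Lie bracket of real vector fields. -/
def bracket (X Y : VField E M) : VField E M := VectorField.mlieBracket 𝓘(ℝ, E) X Y

/-- The right-hand side of the Koszul formula for `2 g(∇_X Y, Z)`. -/
def koszul (g : BilinField E M) (X Y Z : VField E M) (x : M) : ℝ :=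
  dirDeriv (fun y => g y (Y y) (Z y)) x (X x) + dirDeriv (fun y => g y (X y) (Z y)) x (Y x)
    - dirDeriv (fun y => g y (X y) (Y y)) x (Z x)
    + g x (bracket X Y x) (Z x) - g x (bracket X Z x) (Y x) - g x (bracket Y Z x) (X x)

open Classical in
/-- The Levi-Civita derivative `(∇_X Y)_x` of the metric `g`: the vector determined by the Koszul
formula `2 g(∇_X Y, Z) = koszul g X Y Z`. -/
def leviCivita [IsManifold 𝓘(ℂ, E) ω M] (g : BilinField E M) (X Y : VField E M) (x : M) :
    RT E x :=
  if h : ∃ v : RT E x, ∀ Z : VField E M, DiffAt Z x → 2 * g x v (Z x) = koszul g X Y Z x then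
    h.choose
  else 0

/-- `∇ α = 0`, i.e. `(∇_X α) Y = X(α(Y)) - α(∇_X Y) = 0`, with `∇` the Levi-Civita connection
of `g`. -/
def IsParallelForm [IsManifold 𝓘(ℂ, E) ω M] (g : BilinField E M) (α : Form1 E M) : Prop :=
  ∀ (x : M) (X Y : VField E M), SmoothAt X x → SmoothAt Y x →
    dirDeriv (fun y => α y (Y y)) x (X x) = α x (leviCivita g X Y x)

/-- The metric `g` is Kähler on the open set `U`: `∇ J = 0` there. -/
def IsKahlerOn [IsManifold 𝓘(ℂ, E) ω M] (g : BilinField E M) (U : Set M) : Prop :=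
  ∀ x ∈ U, ∀ X Y : VField E M, SmoothAt X x → SmoothAt Y x →
    leviCivita g X (fun y => cxJ y (Y y)) x = cxJ x (leviCivita g X Y x)

/-! ### Locally conformal Kähler metrics, the Lee form, the Lee and anti-Lee fields -/

/-- `U` is an open set and `f : U → ℝ` a `C^∞` function such that `e^{-f} g` is Kähler on `U`. -/
def IsLocalConformalFactor [IsManifold 𝓘(ℂ, E) ω M] (g : BilinField E M) (U : Set M)
    (f : M → ℝ) : Prop :=
  IsOpen U ∧ ContMDiffOn 𝓘(ℝ, E) 𝓘(ℝ, ℝ) ∞ f U ∧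
    IsKahlerOn (fun x => Real.exp (-f x) • g x) U

/-- The metric `g` is locally conformal Kähler. -/
def IsLCK [IsManifold 𝓘(ℂ, E) ω M] (g : BilinField E M) : Prop :=
  ∀ x : M, ∃ (U : Set M) (f : M → ℝ), x ∈ U ∧ IsLocalConformalFactor g U f

open Classical in
/-- The Lee form of a locally conformal Kähler metric `g`: at `x` it is `df_x`, where `e^{-f} g`
is Kähler near `x`. In complex dimension at least `2` two such functions `f` differ by a local
constant, so that the choice does not matter. -/
def leeForm [IsManifold 𝓘(ℂ, E) ω M] (g : BilinField E M) : Form1 E M := fun x =>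
  if h : ∃ (f : M → ℝ) (U : Set M), x ∈ U ∧ IsLocalConformalFactor g U f then
    (mfderiv 𝓘(ℝ, E) 𝓘(ℝ, ℝ) h.choose x : RT E x →L[ℝ] ℝ)
  else 0

open Classical in
/-- The Lee field `B` of `g`, determined by `g(X, B) = leeForm g X` for all `X`. -/
def leeField [IsManifold 𝓘(ℂ, E) ω M] (g : BilinField E M) : VField E M := fun x =>
  if h : ∃ b : RT E x, ∀ v : RT E x, g x v b = leeForm g x v then h.choose else 0

/-- The anti-Lee field `A = -J B`. -/
def antiLeeField [IsManifold 𝓘(ℂ, E) ω M] (g : BilinField E M) : VField E M := fun x =>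
  -cxJ x (leeField g x)

/-- The complex vector field `Z = B + i A`. -/
def leeZ [IsManifold 𝓘(ℂ, E) ω M] (g : BilinField E M) : CxField E M := fun x =>
  (leeField g x, antiLeeField g x)

/-- The vector field `X` is lightlike: it vanishes nowhere and `g(X, X) = 0`. -/
def IsLightlike (g : BilinField E M) (X : VField E M) : Prop :=
  ∀ x : M, X x ≠ 0 ∧ g x (X x) (X x) = 0

/-! ### Foliations

A foliation is given by its tangent bundle, an involutive smooth subbundle of `T(M)`. -/

/-- `D` is (the tangent bundle of) a foliation of `M` with leaves of real dimension `k`: it has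
local `C^∞` frames of `k` vector fields and is involutive. -/
structure IsFoliation [IsManifold 𝓘(ℂ, E) ω M] (D : Distribution E M) (k : ℕ) : Prop where
  frame : ∀ x : M, ∃ U : Set M, IsOpen U ∧ x ∈ U ∧ ∃ X : Fin k → VField E M,
    ∀ y ∈ U, (∀ i, SmoothAt (X i) y) ∧ LinearIndependent ℝ (fun i => X i y) ∧
      Submodule.span ℝ (range fun i => X i y) = D y
  involutive : ∀ (x : M) (X Y : VField E M), SmoothAt X x → SmoothAt Y x →
    (∀ᶠ y in 𝓝 x, X y ∈ D y) → (∀ᶠ y in 𝓝 x, Y y ∈ D y) → bracket X Y x ∈ D x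

/-- There is a smooth curve from `x` to `y` tangent to `D`. -/
def TangentJoined (D : Distribution E M) (x y : M) : Prop :=
  ∃ γ : ℝ → M, ContMDiff 𝓘(ℝ, ℝ) 𝓘(ℝ, E) ∞ γ ∧ γ 0 = x ∧ γ 1 = y ∧
    ∀ t : ℝ, mfderiv 𝓘(ℝ, ℝ) 𝓘(ℝ, E) γ t (1 : ℝ) ∈ D (γ t)

/-- The leaf through `x` of the foliation `D`, i.e. its maximal connected integral manifold through
`x`: the points reached from `x` along finitely many smooth curves tangent to `D`. -/
def leaf (D : Distribution E M) (x : M) : Set M := {y | Relation.EqvGen (TangentJoined D) x y}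

/-- The leaf space of the foliation `D`. -/
def leaves (D : Distribution E M) : Set (Set M) := range (leaf D)

/-- The foliation `D` is a subfoliation of the foliation `D'`. -/
structure IsSubfoliation [IsManifold 𝓘(ℂ, E) ω M] (D D' : Distribution E M) : Prop where
  foliation : ∃ k, IsFoliation D k
  foliation' : ∃ k, IsFoliation D' k
  tangent_le : ∀ x : M, D x ≤ D' x
  leaf_subset : ∀ x : M, leaf D x ⊆ leaf D' x

/-- `D` is a holomorphic foliation of `M` with leaves of complex dimension `k`: it is locally
spanned over `ℂ` by `k` pointwise independent holomorphic vector fields, and is involutive. -/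
structure IsHolomorphicFoliation [IsManifold 𝓘(ℂ, E) ω M] (D : Distribution E M) (k : ℕ) :
    Prop where
  frame : ∀ x : M, ∃ U : Set M, IsOpen U ∧ x ∈ U ∧
    ∃ X : Fin k → ∀ y : M, TangentSpace 𝓘(ℂ, E) y,
      (∀ i, ContMDiffOn 𝓘(ℂ, E) (𝓘(ℂ, E).prod 𝓘(ℂ, E)) ω
        (fun y => (⟨y, X i y⟩ : TangentBundle 𝓘(ℂ, E) M)) U) ∧
      ∀ y ∈ U, LinearIndependent ℂ (fun i => X i y) ∧
        ∀ v : TangentSpace 𝓘(ℂ, E) y,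
          v ∈ Submodule.span ℂ (range fun i => X i y) ↔ (v : RT E y) ∈ D y
  involutive : ∀ (x : M) (X Y : VField E M), SmoothAt X x → SmoothAt Y x →
    (∀ᶠ y in 𝓝 x, X y ∈ D y) → (∀ᶠ y in 𝓝 x, Y y ∈ D y) → bracket X Y x ∈ D x

/-- The first canonical foliation `F`, given by the Pfaff equation `leeForm g = 0`. -/
def firstFoliation [IsManifold 𝓘(ℂ, E) ω M] (g : BilinField E M) : Distribution E M := fun x =>
  LinearMap.ker (leeForm g x).toLinearMap

/-- The second canonical foliation, `x ↦ ℝ A_x + ℝ B_x`. -/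
def secondFoliation [IsManifold 𝓘(ℂ, E) ω M] (g : BilinField E M) : Distribution E M := fun x =>
  Submodule.span ℝ {antiLeeField g x, leeField g x}

/-! ### The CR structure and the Levi form of the leaves of a foliation by real hypersurfaces

In this section `D` is the tangent bundle of such a foliation, so that `D x = T_x(L)` for every
leaf `L` and every point `x` of `L`. -/

/-- `T_{1,0}(D) = T^{1,0}(M) ∩ (D ⊗ ℂ)`: the vectors `v = a + i b` with `a, b ∈ D` and
`J v = i v`. -/
def T10 (D : Distribution E M) (x : M) : Set (RT E x × RT E x) :=
  {v | v.1 ∈ D x ∧ v.2 ∈ D x ∧ cxJ x v.1 = -v.2 ∧ cxJ x v.2 = v.1}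

/-- The Levi distribution `H(D) = Re (T_{1,0}(D) ⊕ conj T_{1,0}(D))`, i.e. the largest
`J`-invariant subspace `D ∩ J D` of `D`. -/
def leviDist (D : Distribution E M) : Distribution E M := fun x =>
  D x ⊓ (D x).comap (cxJ x).toLinearMap

/-- The complex conjugate of a complex vector field. -/
def cxConj (V : CxField E M) : CxField E M := fun x => ((V x).1, -(V x).2)

/-- The complex bilinear extension of the Lie bracket to complex vector fields. -/
def cxBracket (V W : CxField E M) : CxField E M := fun x =>
  (bracket (fun y => (V y).1) (fun y => (W y).1) x - bracket (fun y => (V y).2) (fun y => (W y).2) x,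
    bracket (fun y => (V y).1) (fun y => (W y).2) x + bracket (fun y => (V y).2) (fun y => (W y).1) x)

/-- The Levi form `L(V, conj W) = i π [V, conj W]` at `x`, where `π` is the projection modulo the
Levi distribution. It takes its values in the complexification of `D x ⧸ H(D) x`, a subspace of
that of `T_x(M) ⧸ H(D) x`; as before a pair `(a, b)` stands for `a + i b`. -/
def leviForm (D : Distribution E M) (V W : CxField E M) (x : M) :
    (RT E x ⧸ leviDist D x) × (RT E x ⧸ leviDist D x) :=
  (Submodule.Quotient.mk (-(cxBracket V (cxConj W) x).2),
    Submodule.Quotient.mk (cxBracket V (cxConj W) x).1)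

section Levi

variable [IsManifold 𝓘(ℂ, E) ω M]

/-- `V` is a local `C^∞` section of `T_{1,0}(D)` around `x`. -/
def IsT10SectionAt (D : Distribution E M) (V : CxField E M) (x : M) : Prop :=
  SmoothAt (fun y => (V y).1) x ∧ SmoothAt (fun y => (V y).2) x ∧ ∀ᶠ y in 𝓝 x, V y ∈ T10 D y

/-- The vectors `v ∈ T_{1,0}(D)_x` with `L(v, conj v) = 0`. -/
def leviNull (D : Distribution E M) (x : M) : Set (RT E x × RT E x) :=
  {v | v ∈ T10 D x ∧ ∀ V : CxField E M, IsT10SectionAt D V x → V x = v → leviForm D V V x = 0}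

/-- The vectors `v ∈ T_{1,0}(D)_x` with `L(v, conj w) = 0` for all `w ∈ T_{1,0}(D)_x`. -/
def leviRadical (D : Distribution E M) (x : M) : Set (RT E x × RT E x) :=
  {v | v ∈ T10 D x ∧ ∀ V W : CxField E M, IsT10SectionAt D V x → IsT10SectionAt D W x →
    V x = v → leviForm D V W x = 0}

/-- The Levi form of the leaf `L` of `D` is degenerate (at each point of `L`). -/
def IsLeviDegenerate (D : Distribution E M) (L : Set M) : Prop :=
  ∀ x ∈ L, ∃ v ∈ leviRadical D x, v ≠ 0

/-- The leaf `L` of `D` is Levi-flat: its Levi form vanishes identically. -/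
def IsLeviFlat (D : Distribution E M) (L : Set M) : Prop :=
  ∀ x ∈ L, ∀ V W : CxField E M, IsT10SectionAt D V x → IsT10SectionAt D W x →
    leviForm D V W x = 0

/-- The (tangent bundle of the) foliation `G` of `M` extends the Levi foliation of the leaf `L` of
`D`, which is the foliation of `L` with tangent bundle `H(D)` restricted to `L`. -/
def ExtendsLeviFoliation (G D : Distribution E M) (L : Set M) : Prop :=
  ∀ x ∈ L, G x = leviDist D x

end Levi

end

end IndefLCK

/-
Since `∇ω = 0`, the Lee field `B` is parallel. Comparing `∇` with the Levi-Civita connections of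
the local Kähler metrics `e^{-f} g` shows that `∇ (JB)` takes values in the span of `B` and `JB`.
This span is the orthogonal complement of the Levi distribution `H = ker ω ∩ ker (ω ∘ J)`, and `H`
contains it because `B` is lightlike. So `∇` preserves `H`, hence `H` is involutive and the Levi
form of the leaves vanishes. The same formula gives `[B, JB] = 0` and `[B, JX] = J [B, X]`: the
complex line field `P` is involutive, spanned by the holomorphic field `B`, and equal to `H` if
`n = 2`.

For uniqueness, locally a leaf contains a level set of a potential of `ω`, a real hypersurface. Its
tangent spaces span `T(M)` over `ℂ`, so a holomorphic map that vanishes on the leaf vanishes nearby.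
The coincidence of two holomorphic foliations is locally the vanishing of such a map, and by the
identity theorem it spreads over a connected `M`.
-/

namespace IndefLCK

section ComplexLinear

variable {V W : Type*} [AddCommGroup V] [Module ℂ V] [Module ℝ V] [IsScalarTower ℝ ℂ V]
  [AddCommGroup W] [Module ℂ W] [Module ℝ W] [IsScalarTower ℝ ℂ W]

theorem complex_smul_eq_re_smul_add_im_smul (c : ℂ) (v : V) :
    c • v = c.re • v + c.im • Complex.I • v := by
  have hc : c = c.re • (1 : ℂ) + c.im • Complex.I := by
    rw [Complex.real_smul, Complex.real_smul, mul_one, Complex.re_add_im]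
  conv_lhs => rw [hc, add_smul, smul_assoc, smul_assoc, one_smul]

theorem map_complex_smul_of_map_I_smul (f : V →ₗ[ℝ] W)
    (hf : ∀ v, f (Complex.I • v) = Complex.I • f v) (c : ℂ) (v : V) : f (c • v) = c • f v := by
  rw [complex_smul_eq_re_smul_add_im_smul c v, complex_smul_eq_re_smul_add_im_smul c (f v),
    map_add, map_smul, map_smul, hf]

end ComplexLinear

section SeparatingForms

variable {K V : Type*} [Field K] [AddCommGroup V] [Module K V]

theorem exists_eq_of_separatingLeft [FiniteDimensional K V] {b : V →ₗ[K] V →ₗ[K] K}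
    (hb : b.SeparatingLeft) (φ : V →ₗ[K] K) : ∃ v, b v = φ :=
  ((LinearMap.injective_iff_surjective_of_finrank_eq_finrank Subspace.dual_finrank_eq.symm).1
    (LinearMap.ker_eq_bot.1 (LinearMap.separatingLeft_iff_ker_eq_bot.1 hb))) φ

theorem eq_zero_of_smul_eq_smul (hV : 2 ≤ Module.finrank K V) {β : V → K}
    (hβ : ∀ v w, β v • w = β w • v) (u : V) : β u = 0 := by
  by_contra hu
  have hspan : ∀ w, ∃ c : K, c • u = w := fun w =>
    ⟨(β u)⁻¹ * β w, by rw [mul_smul, inv_smul_eq_iff₀ hu, hβ u w]⟩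
  have := finrank_le_one u hspan
  omega

end SeparatingForms

section LinearForms

theorem linearIndependent_add_smul {K V ι : Type*} [Field K] [AddCommGroup V] [Module K V]
    {u : ι → V} (hu : LinearIndependent K u) {β : V →ₗ[K] K} (hβ : ∀ i, β (u i) = 0) {c : V}
    (hc : β c ≠ 0) (r : ι → K) : LinearIndependent K fun i => u i + r i • c := by
  let P : V →ₗ[K] V := LinearMap.id - β.smulRight ((β c)⁻¹ • c)
  have hP : P ∘ (fun i => u i + r i • c) = u := by
    ext i
    simp [P, hβ, smul_smul, hc]
  exact LinearIndependent.of_comp P (by rwa [hP])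

theorem exists_smul_eq_of_ker_complex {V : Type*} [AddCommGroup V] [Module ℂ V]
    [Module ℝ V] [IsScalarTower ℝ ℂ V] (hV : Module.finrank ℂ V = 2) {α : V →ₗ[ℝ] ℝ}
    (hα : α ≠ 0) {b v : V} (hb : b ≠ 0) (hαb : α b = 0) (hαIb : α (Complex.I • b) = 0)
    (hαv : α v = 0) (hαIv : α (Complex.I • v) = 0) : ∃ c : ℂ, c • b = v := by
  have hfin : FiniteDimensional ℂ V := Module.finite_of_finrank_pos (by omega)
  let φ : Module.Dual ℂ V := Module.Dual.extendRCLike α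
  have hker : ∀ {w : V}, α w = 0 → α (Complex.I • w) = 0 → w ∈ LinearMap.ker φ := by
    intro w hw hIw
    rw [LinearMap.mem_ker, Module.Dual.extendRCLike_apply]
    simp [hw, hIw]
  have hφ : φ ≠ 0 := fun h0 => hα <| LinearMap.ext fun w => by
    rw [← Module.Dual.re_extendRCLike_apply (𝕜 := ℂ), show Module.Dual.extendRCLike α = φ from rfl,
      h0]
    simp
  have hone : Module.finrank ℂ (LinearMap.ker φ) = 1 := by
    have := Module.Dual.finrank_ker_add_one_of_ne_zero hφ
    omega
  obtain ⟨c, hc⟩ := exists_smul_eq_of_finrank_eq_one hone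
    (x := ⟨b, hker hαb hαIb⟩) (by simpa using hb) ⟨v, hker hαv hαIv⟩
  exact ⟨c, congrArg Subtype.val hc⟩

end LinearForms

section Invertible

variable {𝕜 V W : Type*} [NontriviallyNormedField 𝕜]
  [NormedAddCommGroup V] [NormedSpace 𝕜 V] [NormedAddCommGroup W] [NormedSpace 𝕜 W]

theorem eventually_isInvertible [CompleteSpace V] {f : V →L[𝕜] W} (hf : f.IsInvertible) :
    ∀ᶠ f' in 𝓝 f, f'.IsInvertible := by
  obtain ⟨e, rfl⟩ := hf
  exact e.nhds

variable [CompleteSpace 𝕜] [FiniteDimensional 𝕜 V]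

theorem isInvertible_of_injective [FiniteDimensional 𝕜 W]
    (hVW : Module.finrank 𝕜 V = Module.finrank 𝕜 W) {f : V →L[𝕜] W} (hf : Function.Injective f) :
    f.IsInvertible :=
  ⟨(f.toLinearMap.linearEquivOfInjective hf hVW).toContinuousLinearEquiv, by ext; rfl⟩

theorem finrank_continuousDual : Module.finrank 𝕜 (V →L[𝕜] 𝕜) = Module.finrank 𝕜 V :=
  LinearMap.toContinuousLinearMap.finrank_eq.symm.trans Subspace.dual_finrank_eq

end Invertible

section SpanMembership

variable {𝕜 A D V ι ι' : Type*} [NontriviallyNormedField 𝕜]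
  [NormedAddCommGroup A] [NormedSpace 𝕜 A] [NormedAddCommGroup D] [NormedSpace 𝕜 D]
  [NormedAddCommGroup V] [NormedSpace 𝕜 V]

theorem apply_inverse_comp_eq_iff {L : A →L[𝕜] V} {π : V →L[𝕜] A} (h : (π ∘L L).IsInvertible)
    {w : V} :
    L ((π ∘L L).inverse (π w)) = w ↔ ∃ c, L c = w := by
  refine ⟨fun hw => ⟨_, hw⟩, ?_⟩
  rintro ⟨c, rfl⟩
  exact congrArg L (h.inverse_apply_eq.2 rfl)

variable [CompleteSpace 𝕜] [FiniteDimensional 𝕜 V] [Fintype ι] [Finite ι']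

theorem exists_contDiffAt_eq_zero_iff_mem_span {n : WithTop ℕ∞} {F : ι → D → V} {F' : ι' → D → V}
    {u₀ : D} (hF : ∀ᶠ u in 𝓝 u₀, ∀ i, ContDiffAt 𝕜 n (F i) u)
    (hF' : ∀ᶠ u in 𝓝 u₀, ∀ j, ContDiffAt 𝕜 n (F' j) u)
    (hind : LinearIndependent 𝕜 fun j => F' j u₀) :
    ∃ ψ : D → ι → V, ∀ᶠ u in 𝓝 u₀, ContDiffAt 𝕜 n ψ u ∧
      (ψ u = 0 ↔ ∀ i, F i u ∈ Submodule.span 𝕜 (range fun j => F' j u)) := by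
  have := Fintype.ofFinite ι'
  let L : D → (ι' → 𝕜) →L[𝕜] V := fun u => ∑ j, (ContinuousLinearMap.proj j).smulRight (F' j u)
  have hL_apply : ∀ u c, L u c = ∑ j, c j • F' j u := fun u c => by simp [L]
  have hL0 : Function.Injective (L u₀) := fun c c' hcc' => by
    refine linearIndependent_iff_injective_fintypeLinearCombination.1 hind ?_
    simpa only [hL_apply, Fintype.linearCombination_apply] using hcc'
  obtain ⟨π, hπ⟩ := (L u₀).toLinearMap.exists_leftInverse_of_injective (LinearMap.ker_eq_bot.2 hL0)
  let Q : D → (ι' → 𝕜) →L[𝕜] (ι' → 𝕜) := fun u => π.toContinuousLinearMap ∘L L u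
  have hL : ∀ᶠ u in 𝓝 u₀, ContDiffAt 𝕜 n L u := hF'.mono fun u hu =>
    ContDiffAt.sum fun j _ => contDiffAt_const.smulRight (hu j)
  have hQ : ∀ᶠ u in 𝓝 u₀, ContDiffAt 𝕜 n Q u := hL.mono fun u hu => contDiffAt_const.clm_comp hu
  have hQ0 : Q u₀ = ContinuousLinearMap.id 𝕜 _ := ContinuousLinearMap.ext (LinearMap.congr_fun hπ)
  have hinv : ∀ᶠ u in 𝓝 u₀, (Q u).IsInvertible :=
    hQ.self_of_nhds.continuousAt.eventually
      (eventually_isInvertible (hQ0 ▸ ⟨ContinuousLinearEquiv.refl 𝕜 _, rfl⟩))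
  refine ⟨fun u i => L u ((Q u).inverse (π (F i u))) - F i u, ?_⟩
  filter_upwards [hF, hL, hQ, hinv] with u hFu hLu hQu hinvu
  refine ⟨contDiffAt_pi.2 fun i => (hLu.clm_apply ((hinvu.contDiffAt_map_inverse.comp u
    hQu).clm_apply (π.toContinuousLinearMap.contDiff.contDiffAt.comp u (hFu i)))).sub (hFu i), ?_⟩
  simp only [funext_iff, Pi.zero_apply, sub_eq_zero, Submodule.mem_span_range_iff_exists_fun,
    ← hL_apply]
  exact forall_congr' fun i => apply_inverse_comp_eq_iff hinvu

end SpanMembership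

section LevelSets

theorem eventually_contDiffAt_implicitFunction {𝕜 E₁ E₂ F : Type*} [RCLike 𝕜]
    [NormedAddCommGroup E₁] [NormedSpace 𝕜 E₁] [CompleteSpace E₁]
    [NormedAddCommGroup E₂] [NormedSpace 𝕜 E₂] [CompleteSpace E₂]
    [NormedAddCommGroup F] [NormedSpace 𝕜 F] [CompleteSpace F]
    {f : E₁ × E₂ → F} {u : E₁ × E₂} {n : ℕ∞ω}
    (hf : ∀ᶠ w in 𝓝 u, ContDiffAt 𝕜 n f w) (hn : n ≠ 0)
    (hinv : (fderiv 𝕜 f u ∘L .inr 𝕜 E₁ E₂).IsInvertible) :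
    ∀ᶠ t in 𝓝 u.1, ContDiffAt 𝕜 n (hf.self_of_nhds.implicitFunction hn hinv) t := by
  have hf_u := hf.self_of_nhds
  set ψ := hf_u.implicitFunction hn hinv
  have hψ : ContDiffAt 𝕜 n ψ u.1 := hf_u.contDiffAt_implicitFunction hn hinv
  have hψu : (u.1, ψ u.1) = u := Prod.ext rfl (hf_u.implicitFunction_apply_self hn hinv)
  have hgraph : Filter.Tendsto (fun t => (t, ψ t)) (𝓝 u.1) (𝓝 u) := by
    simpa only [ContinuousAt, id_eq, hψu] using continuousAt_id.prodMk hψ.continuousAt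
  have hinv' : ∀ᶠ w in 𝓝 u, (fderiv 𝕜 f w ∘L .inr 𝕜 E₁ E₂).IsInvertible := by
    have hcont : ContinuousAt (fun w => fderiv 𝕜 f w ∘L .inr 𝕜 E₁ E₂) u :=
      (hf_u.fderiv_right (m := 0) (by simpa using ENat.one_le_iff_ne_zero_withTop.2 hn)
        |>.continuousAt).clm_comp continuousAt_const
    exact hcont.eventually (eventually_isInvertible hinv)
  have hcontinuous : ∀ᶠ t in 𝓝 u.1, ContinuousAt ψ t :=
    ((hψ.of_le (ENat.one_le_iff_ne_zero_withTop.2 hn)).eventually (by simp)).mono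
      fun t ht => ht.continuousAt
  have heq : ∀ᶠ t in 𝓝 u.1, f (t, ψ t) = f u := hf_u.eventually_apply_implicitFunction hn hinv
  filter_upwards [hgraph.eventually hf, hgraph.eventually hinv', hcontinuous,
    heq.eventually_nhds, heq] with t hft hinvt hct heqt hut
  refine (hft.contDiffAt_implicitFunction hn hinvt).congr_of_eventuallyEq ?_
  filter_upwards [(continuousAt_id.prodMk hct).eventually
    (hft.eventually_apply_eq_iff_implicitFunction hn hinvt), heqt] with s hs hus
  exact (hs.1 (hus.trans hut.symm)).symm

theorem exists_implicit_real_function {f : ℝ × ℝ → ℝ} (hf : ∀ᶠ p in 𝓝 0, ContDiffAt ℝ ∞ f p)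
    (hfst : fderiv ℝ f 0 (1, 0) = 0) (hsnd : fderiv ℝ f 0 (0, 1) ≠ 0) :
    ∃ ψ : ℝ → ℝ, ψ 0 = 0 ∧ HasDerivAt ψ 0 0 ∧
      ∀ᶠ t in 𝓝 0, ContDiffAt ℝ ∞ ψ t ∧ f (t, ψ t) = f 0 := by
  have hf0 : ContDiffAt ℝ ∞ f 0 := hf.self_of_nhds
  have hinv : (fderiv ℝ f 0 ∘L .inr ℝ ℝ ℝ).IsInvertible := by
    refine isInvertible_of_injective rfl ((injective_iff_map_eq_zero _).2 fun t ht => ?_)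
    have hscale : fderiv ℝ f 0 (t • (0, 1)) = 0 := by simpa using ht
    rw [map_smul, smul_eq_zero] at hscale
    exact hscale.resolve_right hsnd
  refine ⟨hf0.implicitFunction (by simp) hinv, hf0.implicitFunction_apply_self _ hinv, ?_,
    (eventually_contDiffAt_implicitFunction hf (by simp) hinv).and
      (hf0.eventually_apply_implicitFunction (by simp) hinv)⟩
  have hderiv := (hf0.hasStrictFDerivAt_implicitFunction (by simp) hinv).hasFDerivAt.hasDerivAt
  simpa [hfst] using hderiv

theorem exists_germ_curve_in_level_set {E : Type*} [NormedAddCommGroup E] [NormedSpace ℝ E]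
    {F : E → ℝ} {u v : E} (hF : ∀ᶠ w in 𝓝 u, ContDiffAt ℝ ∞ F w) (hne : fderiv ℝ F u ≠ 0)
    (hv : fderiv ℝ F u v = 0) :
    ∃ c : ℝ → E, c 0 = u ∧ HasDerivAt c v 0 ∧
      ∀ᶠ t in 𝓝 0, ContDiffAt ℝ ∞ c t ∧ F (c t) = F u := by
  obtain ⟨w, hw⟩ : ∃ w, fderiv ℝ F u w ≠ 0 := by
    by_contra! hw
    exact hne (ContinuousLinearMap.ext hw)
  have hplane : ContDiff ℝ ∞ fun p : ℝ × ℝ => u + p.1 • v + p.2 • w := by fun_prop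
  have hplane0 : u + (0 : ℝ × ℝ).1 • v + (0 : ℝ × ℝ).2 • w = u := by simp
  have hf : ∀ᶠ p in 𝓝 (0 : ℝ × ℝ), ContDiffAt ℝ ∞ (fun p => F (u + p.1 • v + p.2 • w)) p :=
    (hplane.continuous.tendsto' 0 u hplane0).eventually hF |>.mono
      fun p hp => hp.comp p hplane.contDiffAt
  have hfderiv : ∀ p, fderiv ℝ (fun p : ℝ × ℝ => F (u + p.1 • v + p.2 • w)) 0 p =
      p.2 * fderiv ℝ F u w := by
    intro p
    have hF' : HasFDerivAt F (fderiv ℝ F u) (u + (0 : ℝ × ℝ).1 • v + (0 : ℝ × ℝ).2 • w) := by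
      rw [hplane0]
      exact (hF.self_of_nhds.differentiableAt (by simp)).hasFDerivAt
    have hcomp := hF'.comp 0 (((hasFDerivAt_fst.smul_const v).const_add u).add
      (hasFDerivAt_snd.smul_const w))
    refine congr($hcomp.fderiv p).trans ?_
    simp [hv]
  obtain ⟨ψ, hψ0, hψ', hψ⟩ := exists_implicit_real_function hf (by simp [hfderiv])
    (by simpa [hfderiv] using hw)
  refine ⟨fun t => u + t • v + ψ t • w, by simp [hψ0], ?_, ?_⟩
  · exact ((((hasDerivAt_id (0 : ℝ)).smul_const v).const_add u).add
      (hψ'.smul_const w)).congr_deriv (by simp)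
  · filter_upwards [hψ] with t ⟨ht, htu⟩
    exact ⟨(contDiffAt_const.add (contDiffAt_id.smul contDiffAt_const)).add
      (ht.smul contDiffAt_const), by simpa using htu⟩

theorem exists_reparametrization_forall {p : ℝ → Prop} (hp : ∀ᶠ t in 𝓝 0, p t) :
    ∃ τ : ℝ → ℝ, ContDiff ℝ ∞ τ ∧ τ 0 = 0 ∧ HasDerivAt τ 1 0 ∧ ∀ t, p (τ t) := by
  obtain ⟨δ, hδ, hball⟩ := Metric.eventually_nhds_iff.1 hp
  refine ⟨fun t => δ / 2 * Real.sin (2 / δ * t), by fun_prop, by simp, ?_, fun t => hball ?_⟩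
  · have hsin := (((hasDerivAt_id (0 : ℝ)).const_mul (2 / δ)).sin).const_mul (δ / 2)
    convert! hsin using 1
    simp [field]
  · rw [Real.dist_0_eq_abs, abs_mul, abs_of_pos (half_pos hδ)]
    exact (mul_le_of_le_one_right (half_pos hδ).le (Real.abs_sin_le_one _)).trans_lt
      (half_lt_self hδ)

theorem exists_curve_in_level_set {E : Type*} [NormedAddCommGroup E] [NormedSpace ℝ E] {F : E → ℝ}
    {V : Set E} (hV : IsOpen V) (hF : ContDiffOn ℝ ∞ F V) {u v : E} (hu : u ∈ V)
    (hne : fderiv ℝ F u ≠ 0) (hv : fderiv ℝ F u v = 0) :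
    ∃ c : ℝ → E, ContDiff ℝ ∞ c ∧ c 0 = u ∧ HasDerivAt c v 0 ∧ ∀ t, c t ∈ V ∧ F (c t) = F u := by
  have hFu : ∀ᶠ w in 𝓝 u, ContDiffAt ℝ ∞ F w := by
    filter_upwards [hV.mem_nhds hu] with w hw using hF.contDiffAt (hV.mem_nhds hw)
  obtain ⟨c, hc0, hcv, hc⟩ := exists_germ_curve_in_level_set hFu hne hv
  have hcV : ∀ᶠ t in 𝓝 0, c t ∈ V := hcv.continuousAt (hV.mem_nhds (hc0.symm ▸ hu))
  obtain ⟨τ, hτ, hτ0, hτ', hcτ⟩ := exists_reparametrization_forall (hc.and hcV)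
  refine ⟨c ∘ τ, contDiff_iff_contDiffAt.2 fun t => (hcτ t).1.1.comp t hτ.contDiffAt,
    by simp [hτ0, hc0], ?_, fun t => ⟨(hcτ t).2, (hcτ t).1.2⟩⟩
  simpa using HasDerivAt.scomp 0 (hτ0.symm ▸ hcv) hτ'

end LevelSets

section ComplexUniqueness

theorem eq_top_of_ker_subset {V : Type*} [AddCommGroup V] [Module ℂ V] {α : V →ₗ[ℝ] ℝ}
    (hα : α ≠ 0) {S : Submodule ℂ V} (hS : ∀ v, α v = 0 → v ∈ S) : S = ⊤ := by
  obtain ⟨b, hb⟩ : ∃ b, α b ≠ 0 := by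
    by_contra! hb
    exact hα (LinearMap.ext hb)
  have hbS : b ∈ S := by
    have hmem : ((α (Complex.I • b) : ℂ) - (α b : ℂ) * Complex.I) • b ∈ S := by
      refine hS _ ?_
      rw [sub_smul, mul_smul, Complex.coe_smul, Complex.coe_smul, map_sub, α.map_smul, α.map_smul,
        smul_eq_mul, smul_eq_mul, mul_comm, sub_self]
    refine (S.smul_mem_iff fun h0 => hb ?_).1 hmem
    simpa using congrArg Complex.im h0
  refine eq_top_iff.2 fun v _ => ?_
  have hv : v - ((α v / α b : ℝ) : ℂ) • b ∈ S := by
    refine hS _ ?_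
    rw [Complex.coe_smul, map_sub, map_smul, smul_eq_mul, div_mul_cancel₀ _ hb, sub_self]
  exact (S.sub_mem_iff_left (S.smul_mem _ hbS)).1 hv

variable {E : Type*} [NormedAddCommGroup E] [NormedSpace ℂ E]

theorem mem_tangentConeAt_of_hasDerivAt {S : Set E} {c : ℝ → E} {v : E} (hc : HasDerivAt c v 0)
    (hcS : ∀ t, c t ∈ S) : v ∈ tangentConeAt ℂ S (c 0) := by
  have h1 : v ∈ tangentConeAt ℝ S (c 0) := by
    refine tangentConeAt_mono (range_subset_iff.2 hcS) ?_
    rw [← image_univ]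
    simpa using hc.hasFDerivAt.hasFDerivWithinAt.mapsTo_tangent_cone
      (show (1 : ℝ) ∈ tangentConeAt ℝ univ 0 by simp)
  exact tangentConeAt_mono_field h1

theorem eventually_eq_zero_of_eqOn_uniqueDiffOn {𝕜 E F : Type*} [NontriviallyNormedField 𝕜]
    [CharZero 𝕜] [NormedAddCommGroup E] [NormedSpace 𝕜 E] [NormedAddCommGroup F] [NormedSpace 𝕜 F]
    [CompleteSpace F] {ψ : E → F} {S : Set E} {u : E} (hψ : AnalyticAt 𝕜 ψ u)
    (hS : UniqueDiffOn 𝕜 S) (hu : u ∈ S) (h0 : EqOn ψ 0 S) : ∀ᶠ w in 𝓝 u, ψ w = 0 := by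
  have hderiv : ∀ n, iteratedFDeriv 𝕜 n ψ u = 0 := fun n => by
    rw [← iteratedFDerivWithin_eq_iteratedFDeriv hS hψ.contDiffAt hu,
      iteratedFDerivWithin_congr h0 hu, Pi.zero_def, iteratedFDerivWithin_fun_zero, Pi.zero_apply]
  obtain ⟨p, r, hp⟩ := hψ
  filter_upwards [Metric.eball_mem_nhds u hp.r_pos] with w hw
  have hsum := hp.hasSum_iteratedFDeriv (y := w - u) (by simpa [edist_eq_enorm_sub] using hw)
  simp only [hderiv, zero_apply, smul_zero, add_sub_cancel] at hsum
  exact hsum.unique hasSum_zero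

end ComplexUniqueness

section SeveralComplexVariables

variable {E F : Type*} [NormedAddCommGroup E] [NormedSpace ℂ E]
  [NormedAddCommGroup F] [NormedSpace ℂ F]

theorem differentiableAt_complex_of_fderiv_I_smul {f : E → F} {x : E}
    (hf : DifferentiableAt ℝ f x)
    (hI : ∀ v, fderiv ℝ f x (Complex.I • v) = Complex.I • fderiv ℝ f x v) :
    DifferentiableAt ℂ f x :=
  (differentiableAt_iff_restrictScalars ℝ hf).2
    ⟨{ toFun := fderiv ℝ f x
       map_add' := map_add _
       map_smul' := map_complex_smul_of_map_I_smul (fderiv ℝ f x).toLinearMap hI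
       cont := (fderiv ℝ f x).cont }, rfl⟩

theorem fderiv_real_apply_eq_fderiv_complex {f : E → F} {x : E} (hf : DifferentiableAt ℂ f x)
    (v : E) : fderiv ℝ f x v = fderiv ℂ f x v := by
  rw [hf.fderiv_restrictScalars ℝ, ContinuousLinearMap.coe_restrictScalars']

theorem hasFDerivAt_fderiv_apply {f : E → F} {x : E} (hf : ContDiffAt ℝ 2 f x) (v : E) :
    HasFDerivAt (fun y => fderiv ℝ f y v) ((fderiv ℝ (fderiv ℝ f) x).flip v) x :=
  ((hf.fderiv_right (m := 1) (by norm_num)).differentiableAt (by simp)).hasFDerivAt.clm_apply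
    (hasFDerivAt_const v x) |>.congr_fderiv (by ext; simp)

theorem fderiv_fderiv_I_smul_right {f : E → F} {x : E} (hf : ContDiffAt ℝ 2 f x)
    (hd : ∀ᶠ y in 𝓝 x, DifferentiableAt ℂ f y) (u w : E) :
    fderiv ℝ (fderiv ℝ f) x u (Complex.I • w) = Complex.I • fderiv ℝ (fderiv ℝ f) x u w := by
  have hcomm : (fun y => fderiv ℝ f y (Complex.I • w)) =ᶠ[𝓝 x]
      fun y => Complex.I • fderiv ℝ f y w := by
    filter_upwards [hd] with y hy
    rw [fderiv_real_apply_eq_fderiv_complex hy, fderiv_real_apply_eq_fderiv_complex hy, map_smul]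
  have hderiv := ((hasFDerivAt_fderiv_apply hf (Complex.I • w)).congr_of_eventuallyEq
    hcomm.symm).unique ((hasFDerivAt_fderiv_apply hf w).const_smul Complex.I)
  exact congr($hderiv u)

theorem differentiableAt_complex_fderiv_apply {f : E → F} {x : E} (hf : ContDiffAt ℝ 2 f x)
    (hd : ∀ᶠ y in 𝓝 x, DifferentiableAt ℂ f y) (v : E) :
    DifferentiableAt ℂ (fun y => fderiv ℝ f y v) x := by
  have hsymm : IsSymmSndFDerivAt ℝ f x := hf.isSymmSndFDerivAt (by simp)
  have hv := hasFDerivAt_fderiv_apply hf v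
  refine differentiableAt_complex_of_fderiv_I_smul hv.differentiableAt fun u => ?_
  rw [hv.fderiv, ContinuousLinearMap.flip_apply, ContinuousLinearMap.flip_apply, hsymm.eq,
    fderiv_fderiv_I_smul_right hf hd, hsymm.eq]

theorem contDiffOn_complex_of_real [FiniteDimensional ℂ E] {U : Set E} (hU : IsOpen U) (n : ℕ)
    {f : E → F} (hf : ContDiffOn ℝ ∞ f U) (hd : DifferentiableOn ℂ f U) : ContDiffOn ℂ n f U := by
  induction n generalizing f with
  | zero => exact contDiffOn_zero.2 hf.continuousOn
  | succ n ih =>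
    push_cast
    refine contDiffOn_succ_of_fderiv_apply hd (by simp) fun v => ?_
    have hfderiv : ∀ x ∈ U, fderivWithin ℂ f U x v = fderiv ℝ f x v := fun x hx => by
      rw [fderivWithin_of_isOpen hU hx,
        fderiv_real_apply_eq_fderiv_complex (hd.differentiableAt (hU.mem_nhds hx))]
    refine (ih ?_ fun x hx => ?_).congr hfderiv
    · exact (hf.fderiv_of_isOpen hU (m := ∞) (by simp)).clm_apply contDiffOn_const
    · exact (differentiableAt_complex_fderiv_apply
        (contDiffAt_infty.1 (hf.contDiffAt (hU.mem_nhds hx)) 2)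
        (hd.eventually_differentiableAt (hU.mem_nhds hx)) v).differentiableWithinAt

-- Cauchy's estimate for the first derivative is applied `k` times, on balls of radius `δ`.
theorem norm_iteratedFDeriv_le_of_bounded {f : E → F} {U : Set E} (hU : IsOpen U)
    (hf : ContDiffOn ℂ ∞ f U) {C δ : ℝ} (hδ : 0 < δ) (hC : ∀ y ∈ U, ‖f y‖ ≤ C) (k : ℕ)
    {y : E} (hball : Metric.ball y (k * δ) ⊆ U) (hy : y ∈ U) :
    ‖iteratedFDeriv ℂ k f y‖ ≤ C * (2 / δ) ^ k := by
  induction k generalizing y with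
  | zero => simpa using hC y hy
  | succ k ih =>
    have hsub : ∀ z ∈ Metric.ball y δ, Metric.ball z (k * δ) ⊆ U ∧ z ∈ U := by
      intro z hz
      refine ⟨(Metric.ball_subset_ball' ?_).trans hball, hball (Metric.ball_subset_ball ?_ hz)⟩
      · push_cast
        rw [Metric.mem_ball] at hz
        linarith
      · push_cast
        nlinarith [(Nat.cast_nonneg k : (0 : ℝ) ≤ k)]
    have hbound : ∀ z ∈ Metric.ball y δ, ‖iteratedFDeriv ℂ k f z‖ ≤ C * (2 / δ) ^ k :=
      fun z hz => ih (hsub z hz).1 (hsub z hz).2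
    have hmaps : MapsTo (iteratedFDeriv ℂ k f) (Metric.ball y δ)
        (Metric.closedBall (iteratedFDeriv ℂ k f y) (2 * (C * (2 / δ) ^ k))) := fun z hz => by
      rw [mem_closedBall_iff_norm]
      refine (norm_sub_le _ _).trans ?_
      linarith [hbound z hz, hbound y (Metric.mem_ball_self hδ)]
    have hd : DifferentiableOn ℂ (iteratedFDeriv ℂ k f) (Metric.ball y δ) := fun z hz =>
      ((hf.contDiffAt (hU.mem_nhds (hsub z hz).2)).differentiableAt_iteratedFDeriv
        (m := k) (by exact_mod_cast ENat.natCast_lt_top k)).differentiableWithinAt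
    calc ‖iteratedFDeriv ℂ (k + 1) f y‖ = ‖fderiv ℂ (iteratedFDeriv ℂ k f) y‖ :=
          norm_fderiv_iteratedFDeriv.symm
      _ ≤ 2 * (C * (2 / δ) ^ k) / δ := Complex.norm_fderiv_le_div_of_mapsTo_ball hd hmaps hδ
      _ = C * (2 / δ) ^ (k + 1) := by rw [pow_succ]; field_simp

theorem norm_inv_factorial_smul_iteratedFDeriv_le {f : E → F} {x : E} {C R : ℝ} (hR : 0 < R)
    (hf : ContDiffOn ℂ ∞ f (Metric.ball x R)) (hC : ∀ y ∈ Metric.ball x R, ‖f y‖ ≤ C) (k : ℕ) :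
    ‖(k.factorial : ℂ)⁻¹ • iteratedFDeriv ℂ k f x‖ ≤ C * (2 * Real.exp 1 / R) ^ k := by
  have hx : x ∈ Metric.ball x R := Metric.mem_ball_self hR
  have hC₀ : 0 ≤ C := (norm_nonneg _).trans (hC x hx)
  rcases k.eq_zero_or_pos with rfl | hk
  · simpa using hC x hx
  have hk' : (0 : ℝ) < k := by exact_mod_cast hk
  have hcauchy : ‖iteratedFDeriv ℂ k f x‖ ≤ C * (2 / (R / k)) ^ k :=
    norm_iteratedFDeriv_le_of_bounded Metric.isOpen_ball hf (by positivity) hC k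
      (by rw [mul_div_cancel₀ _ hk'.ne']) hx
  have hfact : (k : ℝ) ^ k / k.factorial ≤ Real.exp 1 ^ k := by
    rw [← Real.exp_nat_mul, mul_one]
    exact Real.pow_div_factorial_le_exp _ k.cast_nonneg k
  calc ‖(k.factorial : ℂ)⁻¹ • iteratedFDeriv ℂ k f x‖
      = (k.factorial : ℝ)⁻¹ * ‖iteratedFDeriv ℂ k f x‖ := by
        rw [norm_smul, norm_inv, Complex.norm_natCast]
    _ ≤ (k.factorial : ℝ)⁻¹ * (C * (2 / (R / k)) ^ k) := by gcongr
    _ = C * (2 / R) ^ k * ((k : ℝ) ^ k / k.factorial) := by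
        rw [div_div_eq_mul_div, div_pow, div_pow, mul_pow]; field_simp
    _ ≤ C * (2 / R) ^ k * Real.exp 1 ^ k := by gcongr
    _ = C * (2 * Real.exp 1 / R) ^ k := by rw [mul_assoc, ← mul_pow]; congr 2; ring

theorem iteratedDeriv_comp_add_smul {f : E → F} {U : Set E} (hU : IsOpen U)
    (hf : ContDiffOn ℂ ∞ f U) (x v : E) (k : ℕ) {t : ℂ} (ht : x + t • v ∈ U) :
    iteratedDeriv k (fun s : ℂ => f (x + s • v)) t
      = iteratedFDeriv ℂ k f (x + t • v) fun _ => v := by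
  induction k generalizing t with
  | zero => simp
  | succ k ih =>
    have hev : iteratedDeriv k (fun s : ℂ => f (x + s • v)) =ᶠ[𝓝 t]
        fun s => iteratedFDeriv ℂ k f (x + s • v) fun _ => v := by
      have hc : ContinuousAt (fun s : ℂ => x + s • v) t := by fun_prop
      filter_upwards [hc.preimage_mem_nhds (hU.mem_nhds ht)] with s hs using ih hs
    rw [iteratedDeriv_succ, hev.deriv_eq]
    exact ((hf.contDiffAt (hU.mem_nhds ht)).of_le (by exact_mod_cast le_top)).deriv_fderiv_add_smul

theorem hasSum_inv_factorial_smul_iteratedFDeriv [CompleteSpace F] {f : E → F} {x v : E} {R : ℝ}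
    (hf : ContDiffOn ℂ ∞ f (Metric.ball x R)) (hv : ‖v‖ < R) :
    HasSum (fun k : ℕ => (k.factorial : ℂ)⁻¹ • iteratedFDeriv ℂ k f x fun _ => v) (f (x + v)) := by
  obtain ⟨ρ, hρ, hρv⟩ : ∃ ρ : ℝ, 1 < ρ ∧ ρ * ‖v‖ < R := by
    rcases (norm_nonneg v).eq_or_lt with h0 | h0
    · exact ⟨2, by norm_num, by rwa [← h0, mul_zero, h0]⟩
    · obtain ⟨ρ, h1, h2⟩ := exists_between ((one_lt_div h0).2 hv)
      exact ⟨ρ, h1, (lt_div_iff₀ h0).1 h2⟩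
  have hmaps : MapsTo (fun t : ℂ => x + t • v) (Metric.ball 0 ρ) (Metric.ball x R) := by
    intro t ht
    rw [mem_ball_zero_iff] at ht
    rw [mem_ball_iff_norm, add_sub_cancel_left, norm_smul]
    exact (mul_le_mul_of_nonneg_right ht.le (norm_nonneg v)).trans_lt hρv
  have hd : DifferentiableOn ℂ (fun t : ℂ => f (x + t • v)) (Metric.ball 0 ρ) :=
    (hf.differentiableOn (by simp)).comp (by fun_prop) hmaps
  have hsum := Complex.hasSum_taylorSeries_on_ball hd (z := 1) (by simpa using hρ)
  simp only [sub_zero, one_pow, one_smul] at hsum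
  convert hsum using 3 with k
  rw [iteratedDeriv_comp_add_smul Metric.isOpen_ball hf x v k
    (by simpa using (norm_nonneg v).trans_lt hv), zero_smul, add_zero]

theorem analyticAt_of_contDiffOn [CompleteSpace F] {f : E → F} {U : Set E} (hU : IsOpen U)
    (hf : ContDiffOn ℂ ∞ f U) {x : E} (hx : x ∈ U) : AnalyticAt ℂ f x := by
  have hcont : ContinuousAt (fun y => ‖f y‖) x := (hf.contDiffAt (hU.mem_nhds hx)).continuousAt.norm
  obtain ⟨R, hR, hball⟩ : ∃ R > 0, Metric.ball x R ⊆ U ∩ {y | ‖f y‖ ≤ ‖f x‖ + 1} :=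
    Metric.mem_nhds_iff.1 (Filter.inter_mem (hU.mem_nhds hx)
      ((hcont.eventually (gt_mem_nhds (lt_add_one _))).mono fun y hy => le_of_lt hy))
  have hfR : ContDiffOn ℂ ∞ f (Metric.ball x R) := hf.mono fun y hy => (hball hy).1
  let p : FormalMultilinearSeries ℂ E F := fun k => (k.factorial : ℂ)⁻¹ • iteratedFDeriv ℂ k f x
  set r : ℝ := R / (2 * Real.exp 1) with hr_def
  have hr : 0 < r := by positivity
  have hrR : r ≤ R := div_le_self hR.le (by nlinarith [Real.add_one_le_exp (1 : ℝ)])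
  refine ⟨p, ENNReal.ofReal r, ?_, ENNReal.ofReal_pos.2 hr, fun {v} hv => ?_⟩
  · refine p.le_radius_of_bound (‖f x‖ + 1) (r := r.toNNReal) fun k => ?_
    rw [Real.coe_toNNReal _ hr.le, ← le_div_iff₀ (by positivity)]
    refine (norm_inv_factorial_smul_iteratedFDeriv_le hR hfR (fun y hy => (hball hy).2) k).trans ?_
    rw [div_eq_mul_inv (‖f x‖ + 1), ← inv_pow, hr_def, inv_div]
  · rw [Metric.eball_ofReal, mem_ball_zero_iff] at hv
    exact hasSum_inv_factorial_smul_iteratedFDeriv hfR (hv.trans_le hrR)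

end SeveralComplexVariables

section ReadInChart

variable {𝕜 E F M : Type*} [NontriviallyNormedField 𝕜] [NormedAddCommGroup E] [NormedSpace 𝕜 E]
  [NormedAddCommGroup F] [NormedSpace 𝕜 F] [TopologicalSpace M] [ChartedSpace E M] {f : M → F}
  {x y : M}

theorem contMDiffAt_iff_contDiffAt_comp_chart_symm {n : WithTop ℕ∞} [IsManifold 𝓘(𝕜, E) n M]
    (hy : y ∈ (chartAt E x).source) :
    ContMDiffAt 𝓘(𝕜, E) 𝓘(𝕜, F) n f y ↔
      ContDiffAt 𝕜 n (f ∘ (chartAt E x).symm) (chartAt E x y) := by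
  rw [contMDiffAt_iff_source_of_mem_source hy, modelWithCornersSelf_coe, range_id,
    contMDiffWithinAt_univ]
  exact contMDiffAt_iff_contDiffAt

theorem mdifferentiableAt_iff_differentiableAt_comp_chart_symm [IsManifold 𝓘(𝕜, E) 1 M]
    (hy : y ∈ (chartAt E x).source) :
    MDifferentiableAt 𝓘(𝕜, E) 𝓘(𝕜, F) f y ↔
      DifferentiableAt 𝕜 (f ∘ (chartAt E x).symm) (chartAt E x y) := by
  rw [mdifferentiableAt_iff_source_of_mem_source hy, modelWithCornersSelf_coe, range_id,
    mdifferentiableWithinAt_univ]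
  exact mdifferentiableAt_iff_differentiableAt

end ReadInChart

variable {E : Type*} [NormedAddCommGroup E] [NormedSpace ℂ E]
  {M : Type*} [TopologicalSpace M] [ChartedSpace E M]

section DirectionalDerivative

variable {f h : M → ℝ} {x : M}

theorem dirDeriv_eq_mvfderiv (f : M → ℝ) (x : M) (v : RT E x) :
    dirDeriv f x v = mvfderiv 𝓘(ℝ, E) f x v := rfl

theorem dirDeriv_add_apply (f : M → ℝ) (x : M) (v w : RT E x) :
    dirDeriv f x (v + w) = dirDeriv f x v + dirDeriv f x w := by
  simp only [dirDeriv_eq_mvfderiv, map_add]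

theorem dirDeriv_smul_apply (f : M → ℝ) (x : M) (c : ℝ) (v : RT E x) :
    dirDeriv f x (c • v) = c * dirDeriv f x v := by
  simp only [dirDeriv_eq_mvfderiv, map_smul, smul_eq_mul]

theorem dirDeriv_add (hf : MDifferentiableAt 𝓘(ℝ, E) 𝓘(ℝ, ℝ) f x)
    (hh : MDifferentiableAt 𝓘(ℝ, E) 𝓘(ℝ, ℝ) h x) (v : RT E x) :
    dirDeriv (fun y => f y + h y) x v = dirDeriv f x v + dirDeriv h x v :=
  congr($(mvfderiv_add hf hh) v)

theorem dirDeriv_mul (hf : MDifferentiableAt 𝓘(ℝ, E) 𝓘(ℝ, ℝ) f x)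
    (hh : MDifferentiableAt 𝓘(ℝ, E) 𝓘(ℝ, ℝ) h x) (v : RT E x) :
    dirDeriv (fun y => f y * h y) x v = f x * dirDeriv h x v + h x * dirDeriv f x v :=
  congr($(mvfderiv_mul hf hh) v)

theorem dirDeriv_congr (hfh : f =ᶠ[𝓝 x] h) (v : RT E x) : dirDeriv f x v = dirDeriv h x v := by
  simp only [dirDeriv, hfh.mfderiv_eq]
  rfl

theorem dirDeriv_eq_zero (hf : ∀ᶠ y in 𝓝 x, f y = 0) (v : RT E x) : dirDeriv f x v = 0 := by
  rw [dirDeriv_congr (h := fun _ => 0) hf v, dirDeriv_eq_mvfderiv, mvfderiv_const]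
  rfl

theorem mdifferentiableAt_exp_neg (hf : MDifferentiableAt 𝓘(ℝ, E) 𝓘(ℝ, ℝ) f x) :
    MDifferentiableAt 𝓘(ℝ, E) 𝓘(ℝ, ℝ) (fun y => Real.exp (-f y)) x :=
  (DifferentiableAt.mdifferentiableAt (f := fun t : ℝ => Real.exp (-t)) (by fun_prop)).comp x hf

theorem dirDeriv_exp_neg (hf : MDifferentiableAt 𝓘(ℝ, E) 𝓘(ℝ, ℝ) f x) (v : RT E x) :
    dirDeriv (fun y => Real.exp (-f y)) x v = -Real.exp (-f x) * dirDeriv f x v := by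
  have hexp : HasDerivAt (fun t : ℝ => Real.exp (-t)) (-Real.exp (-f x)) (f x) := by
    simpa using (hasDerivAt_neg (f x)).exp
  have hcomp : mfderiv 𝓘(ℝ, E) 𝓘(ℝ, ℝ) (fun y => Real.exp (-f y)) x = _ :=
    (hexp.hasFDerivAt.hasMFDerivAt.comp x hf.hasMFDerivAt).mfderiv
  rw [dirDeriv, hcomp]
  exact mul_comm (dirDeriv f x v) (-Real.exp (-f x))

end DirectionalDerivative

section TangentSpace

instance tangentSpaceComplexModule (x : M) : Module ℂ (RT E x) := inferInstanceAs (Module ℂ E)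

instance tangentSpaceIsScalarTower (x : M) : IsScalarTower ℝ ℂ (RT E x) :=
  inferInstanceAs (IsScalarTower ℝ ℂ E)

theorem cxJ_eq_I_smul (x : M) (v : RT E x) : cxJ x v = Complex.I • v := rfl

theorem complex_smul_eq_re_smul_add_im_smul_cxJ (x : M) (c : ℂ) (v : RT E x) :
    c • v = c.re • v + c.im • cxJ x v :=
  complex_smul_eq_re_smul_add_im_smul c v

@[simp] theorem cxJ_cxJ (x : M) (v : RT E x) : cxJ x (cxJ x v) = -v := by
  rw [cxJ_eq_I_smul, cxJ_eq_I_smul, smul_smul, Complex.I_mul_I, neg_one_smul]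

variable [FiniteDimensional ℂ E]

instance tangentSpaceFiniteDimensionalComplex (x : M) : FiniteDimensional ℂ (RT E x) :=
  inferInstanceAs (FiniteDimensional ℂ E)

instance tangentSpaceFiniteDimensionalReal (x : M) : FiniteDimensional ℝ (RT E x) :=
  FiniteDimensional.complexToReal E

instance completeSpaceOfFiniteDimensional : CompleteSpace E := FiniteDimensional.complete ℂ E

end TangentSpace

section Coordinates

variable [IsManifold 𝓘(ℂ, E) ω M] {x y : M}

/-- The coordinates of a tangent vector at `y` in the preferred holomorphic chart at `x`
(meaningful for `y` in the domain of that chart). -/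
noncomputable def coord (x y : M) : RT E y →L[ℝ] E :=
  (trivializationAt E (TangentSpace 𝓘(ℝ, E)) x).continuousLinearMapAt ℝ y

theorem coord_eq_trivializationAt (hy : y ∈ (chartAt E x).source) (v : RT E y) :
    coord x y v = (trivializationAt E (TangentSpace 𝓘(ℝ, E)) x ⟨y, v⟩).2 := by
  rw [coord, Bundle.Trivialization.continuousLinearMapAt_apply,
    Bundle.Trivialization.linearMapAt_apply,
    if_pos (show y ∈ (trivializationAt E (TangentSpace 𝓘(ℝ, E)) x).baseSet from hy)]

theorem differentiableAt_transition (hy : y ∈ (chartAt E x).source) :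
    DifferentiableAt ℂ (chartAt E x ∘ (chartAt E y).symm) (chartAt E y y) := by
  have hcompat := (contDiffGroupoid ω 𝓘(ℂ, E)).compatible (chart_mem_atlas E y)
    (chart_mem_atlas E x)
  rw [contDiffGroupoid, mem_groupoid_of_pregroupoid] at hcompat
  have htrans : ContDiffOn ℂ ω (chartAt E x ∘ (chartAt E y).symm)
      ((chartAt E y).symm.trans (chartAt E x)).source :=
    hcompat.1.congr_mono (fun _ _ => rfl) (by simp)
  exact (htrans.contDiffAt (((chartAt E y).symm.trans (chartAt E x)).open_source.mem_nhds
    (by simp [hy]))).differentiableAt (by simp)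

theorem coord_eq_fderiv_transition (hy : y ∈ (chartAt E x).source) (v : RT E y) :
    coord x y v = fderiv ℂ (chartAt E x ∘ (chartAt E y).symm) (chartAt E y y) (v : E) := by
  rw [coord_eq_trivializationAt hy, TangentBundle.trivializationAt_apply]
  refine Eq.trans ?_
    (fderiv_real_apply_eq_fderiv_complex (differentiableAt_transition hy) (v : E))
  simp only [modelWithCornersSelf_coe, range_id, fderivWithin_univ]
  rfl

theorem coord_eq_complex_trivializationAt (hy : y ∈ (chartAt E x).source) (v : RT E y) :
    coord x y v =
      (trivializationAt E (TangentSpace 𝓘(ℂ, E)) x ⟨y, (v : TangentSpace 𝓘(ℂ, E) y)⟩).2 := by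
  rw [coord_eq_fderiv_transition hy, TangentBundle.trivializationAt_apply]
  simp only [modelWithCornersSelf_coe, range_id, fderivWithin_univ]
  rfl

theorem coord_smul (hy : y ∈ (chartAt E x).source) (c : ℂ) (v : RT E y) :
    coord x y (c • v) = c • coord x y v := by
  rw [coord_eq_fderiv_transition hy, coord_eq_fderiv_transition hy]
  exact (fderiv ℂ (chartAt E x ∘ (chartAt E y).symm) (chartAt E y y)).map_smul c (v : E)

theorem coord_cxJ (hy : y ∈ (chartAt E x).source) (v : RT E y) :
    coord x y (cxJ y v) = Complex.I • coord x y v :=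
  coord_smul hy Complex.I v

theorem coord_bijective (hy : y ∈ (chartAt E x).source) :
    Function.Bijective (coord (E := E) x y) := by
  have heq : ⇑(coord (E := E) x y) =
      (trivializationAt E (TangentSpace 𝓘(ℝ, E)) x).continuousLinearEquivAt ℝ y hy :=
    funext fun v => coord_eq_trivializationAt hy v
  rw [heq]
  exact ContinuousLinearEquiv.bijective _

theorem coord_self (x : M) (v : RT E x) : coord x x v = v := by
  have hid : (chartAt E x ∘ (chartAt E x).symm) =ᶠ[𝓝 (chartAt E x x)] id := by
    filter_upwards [(chartAt E x).open_target.mem_nhds (mem_chart_target E x)] with z hz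
    exact (chartAt E x).right_inv hz
  rw [coord_eq_fderiv_transition (mem_chart_source E x), hid.fderiv_eq, fderiv_id]
  rfl

theorem smoothAt_iff_coord {X : VField E M} (hy : y ∈ (chartAt E x).source) :
    SmoothAt X y ↔ ContMDiffAt 𝓘(ℝ, E) 𝓘(ℝ, E) ∞ (fun z => coord x z (X z)) y := by
  rw [SmoothAt, Bundle.Trivialization.contMDiffAt_section_iff
    (e := trivializationAt E (TangentSpace 𝓘(ℝ, E)) x) hy]
  refine Filter.EventuallyEq.contMDiffAt_iff ?_
  filter_upwards [(chartAt E x).open_source.mem_nhds hy] with z hz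
  rw [coord_eq_trivializationAt hz]

theorem eventuallyEq_coord_cxJ (x : M) (X : VField E M) :
    (fun y => coord x y (cxJ y (X y))) =ᶠ[𝓝 x]
      (Complex.I • ContinuousLinearMap.id ℝ E) ∘ fun y => coord x y (X y) := by
  filter_upwards [(chartAt E x).open_source.mem_nhds (mem_chart_source E x)] with y hy
  exact coord_cxJ hy _

end Coordinates

section VectorFields

variable [IsManifold 𝓘(ℂ, E) ω M] {X Y : VField E M} {f : M → ℝ} {x y : M}

theorem SmoothAt.diffAt (h : SmoothAt X x) : DiffAt X x :=
  ContMDiffAt.mdifferentiableAt h (by simp)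

theorem SmoothAt.cxJ (h : SmoothAt X x) : SmoothAt (fun y => cxJ y (X y)) x := by
  rw [smoothAt_iff_coord (mem_chart_source E x)] at h ⊢
  exact ((Complex.I • ContinuousLinearMap.id ℝ E).contMDiff.contMDiffAt.comp x
    h).congr_of_eventuallyEq (eventuallyEq_coord_cxJ x X)

theorem DiffAt.smul (hf : MDifferentiableAt 𝓘(ℝ, E) 𝓘(ℝ, ℝ) f x) (hX : DiffAt X x) :
    DiffAt (fun y => f y • X y) x :=
  MDifferentiableAt.smul_section hf hX

theorem SmoothAt.add (hX : SmoothAt X x) (hY : SmoothAt Y x) : SmoothAt (fun y => X y + Y y) x :=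
  ContMDiffAt.add_section hX hY

theorem SmoothAt.neg (hX : SmoothAt X x) : SmoothAt (fun y => -X y) x :=
  ContMDiffAt.neg_section hX

theorem SmoothAt.smul (hf : ContMDiffAt 𝓘(ℝ, E) 𝓘(ℝ, ℝ) ∞ f x) (hX : SmoothAt X x) :
    SmoothAt (fun y => f y • X y) x :=
  ContMDiffAt.smul_section hf hX

/-- The vector field around `x` with the same constant coordinates as `v` in the preferred chart
at `x`. -/
noncomputable def extendConst {x : M} (v : RT E x) : VField E M := FiberBundle.extend E v

@[simp] theorem extendConst_self (v : RT E x) : extendConst v x = v :=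
  FiberBundle.extend_apply_self _ _

theorem coord_extendConst (v : RT E x) (hy : y ∈ (chartAt E x).source) :
    coord x y (extendConst v y) = v := by
  rw [coord_eq_trivializationAt hy, extendConst, FiberBundle.extend,
    Bundle.Trivialization.apply_mk_symm _ hy, ← coord_eq_trivializationAt (mem_chart_source E x),
    coord_self]

theorem smoothAt_extendConst (v : RT E x) (hy : y ∈ (chartAt E x).source) :
    SmoothAt (extendConst v) y := by
  rw [smoothAt_iff_coord hy]
  have hconst : ContMDiffAt 𝓘(ℝ, E) 𝓘(ℝ, E) ∞ (fun _ : M => (id v : E)) y := contMDiffAt_const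
  refine hconst.congr_of_eventuallyEq ?_
  filter_upwards [(chartAt E x).open_source.mem_nhds hy] with z hz using coord_extendConst v hz

theorem smoothAt_extendConst_self (v : RT E x) : SmoothAt (extendConst v) x :=
  smoothAt_extendConst v (mem_chart_source E x)

theorem SmoothBilin.mdifferentiableAt_apply {g : BilinField E M} (hg : SmoothBilin g)
    (hX : DiffAt X x) (hY : DiffAt Y x) :
    MDifferentiableAt 𝓘(ℝ, E) 𝓘(ℝ, ℝ) (fun y => g y (X y) (Y y)) x := by
  have hsec : MDifferentiableAt 𝓘(ℝ, E) (𝓘(ℝ, E).prod 𝓘(ℝ, ℝ))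
      (fun m => Bundle.TotalSpace.mk' ℝ (E := Bundle.Trivial M ℝ) m (g m (X m) (Y m))) x :=
    MDifferentiableAt.clm_bundle_apply₂ (F₁ := E) (F₂ := E)
      (hg.contMDiffAt.mdifferentiableAt (by simp)) hX hY
  rwa [mdifferentiableAt_section] at hsec

end VectorFields

section Bracket

variable {X Y Z : VField E M} {f : M → ℝ} {x : M}

theorem bracket_swap (X Y : VField E M) (x : M) : bracket X Y x = -bracket Y X x :=
  VectorField.mlieBracket_swap_apply

theorem bracket_congr {X' Y' : VField E M} (hX : X =ᶠ[𝓝 x] X') (hY : Y =ᶠ[𝓝 x] Y') :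
    bracket X Y x = bracket X' Y' x :=
  hX.mlieBracket_vectorField_eq hY

variable [IsManifold 𝓘(ℂ, E) ω M] [CompleteSpace E]

theorem bracket_add_right (hY : DiffAt Y x) (hZ : DiffAt Z x) :
    bracket X (fun y => Y y + Z y) x = bracket X Y x + bracket X Z x :=
  VectorField.mlieBracket_add_right hY hZ

theorem bracket_smul_right (hf : MDifferentiableAt 𝓘(ℝ, E) 𝓘(ℝ, ℝ) f x) (hY : DiffAt Y x) :
    bracket X (fun y => f y • Y y) x = dirDeriv f x (X x) • Y x + f x • bracket X Y x :=
  VectorField.mlieBracket_smul_right hf hY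

end Bracket

section Metric

/-- The pointwise part of the notion of a semi-Riemannian metric, sufficient for the existence of
the Levi-Civita derivative at `x`: a symmetric field of bilinear forms which is differentiable
and nondegenerate at `x`. -/
structure IsMetricAt [IsManifold 𝓘(ℂ, E) ω M] (g : BilinField E M) (x : M) : Prop where
  diff : ∀ X Y : VField E M, DiffAt X x → DiffAt Y x →
    MDifferentiableAt 𝓘(ℝ, E) 𝓘(ℝ, ℝ) (fun y => g y (X y) (Y y)) x
  symm : ∀ (y : M) (v w : RT E y), g y v w = g y w v
  nondegenerate : ∀ v : RT E x, (∀ w : RT E x, g x v w = 0) → v = 0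

theorem exists_representative [FiniteDimensional ℂ E] {g : BilinField E M} {x : M}
    (hg : ∀ v : RT E x, (∀ w : RT E x, g x v w = 0) → v = 0) (φ : RT E x →ₗ[ℝ] ℝ) :
    ∃ v : RT E x, ∀ w, g x v w = φ w := by
  obtain ⟨v, hv⟩ := exists_eq_of_separatingLeft (b := (g x).toLinearMap₁₂) hg φ
  exact ⟨v, fun w => congr($hv w)⟩

variable [IsManifold 𝓘(ℂ, E) ω M]

section LeviCivita

variable {g : BilinField E M} {x : M} {X Y Z : VField E M} {f : M → ℝ}

theorem IsMetricAt.conformal (hg : IsMetricAt g x) (hf : MDifferentiableAt 𝓘(ℝ, E) 𝓘(ℝ, ℝ) f x) :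
    IsMetricAt (fun y => Real.exp (-f y) • g y) x where
  diff X Y hX hY := (mdifferentiableAt_exp_neg hf).mul (hg.diff X Y hX hY)
  symm y v w := congrArg (Real.exp (-f y) • ·) (hg.symm y v w)
  nondegenerate v hv := hg.nondegenerate v fun w =>
    (mul_eq_zero.1 (hv w)).resolve_left (Real.exp_pos _).ne'

variable [FiniteDimensional ℂ E]

theorem tensorialAt_koszul (hg : IsMetricAt g x) (hX : DiffAt X x) (hY : DiffAt Y x) :
    TensorialAt 𝓘(ℝ, E) E (fun Z : VField E M => koszul g X Y Z x) x where
  smul := by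
    intro f Z hf hZ
    have hdir : ∀ W : VField E M, DiffAt W x → ∀ u : RT E x,
        dirDeriv (fun y => g y (W y) (f y • Z y)) x u =
          f x * dirDeriv (fun y => g y (W y) (Z y)) x u + g x (W x) (Z x) * dirDeriv f x u := by
      intro W hW u
      rw [← dirDeriv_mul hf (hg.diff W Z hW hZ)]
      simp only [map_smul, smul_eq_mul]
    change koszul g X Y (fun y => f y • Z y) x = f x • koszul g X Y Z x
    unfold koszul
    rw [hdir Y hY, hdir X hX, bracket_smul_right hf hZ, bracket_smul_right hf hZ,
      dirDeriv_smul_apply]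
    simp only [map_add, map_smul, add_apply, smul_apply, smul_eq_mul]
    rw [hg.symm x (Z x) (Y x), hg.symm x (Z x) (X x)]
    ring
  add := by
    intro Z Z' hZ hZ'
    have hdir : ∀ W : VField E M, DiffAt W x → ∀ u : RT E x,
        dirDeriv (fun y => g y (W y) (Z y + Z' y)) x u =
          dirDeriv (fun y => g y (W y) (Z y)) x u + dirDeriv (fun y => g y (W y) (Z' y)) x u := by
      intro W hW u
      rw [← dirDeriv_add (hg.diff W Z hW hZ) (hg.diff W Z' hW hZ')]
      simp only [map_add]
    change koszul g X Y (fun y => Z y + Z' y) x = koszul g X Y Z x + koszul g X Y Z' x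
    unfold koszul
    rw [hdir Y hY, hdir X hX, bracket_add_right hZ hZ', bracket_add_right hZ hZ',
      dirDeriv_add_apply]
    simp only [map_add, add_apply]
    ring

theorem leviCivita_spec (hg : IsMetricAt g x) (hX : DiffAt X x) (hY : DiffAt Y x)
    (hZ : DiffAt Z x) : 2 * g x (leviCivita g X Y x) (Z x) = koszul g X Y Z x := by
  have hex : ∃ v : RT E x, ∀ Z : VField E M, DiffAt Z x → 2 * g x v (Z x) = koszul g X Y Z x := by
    have hT := tensorialAt_koszul hg hX hY
    obtain ⟨v, hv⟩ := exists_representative hg.nondegenerate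
      ((2 : ℝ)⁻¹ • (TensorialAt.mkHom (I := 𝓘(ℝ, E)) (F := E) _ x hT).toLinearMap)
    refine ⟨v, fun Z hZ => ?_⟩
    rw [hv, LinearMap.smul_apply, smul_eq_mul, mul_inv_cancel_left₀ two_ne_zero]
    exact TensorialAt.mkHom_apply hT hZ
  unfold leviCivita
  rw [dif_pos hex]
  exact hex.choose_spec Z hZ

theorem leviCivita_metric (hg : IsMetricAt g x) (hX : DiffAt X x) (hY : DiffAt Y x)
    (hZ : DiffAt Z x) :
    dirDeriv (fun y => g y (Y y) (Z y)) x (X x) =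
      g x (leviCivita g X Y x) (Z x) + g x (Y x) (leviCivita g X Z x) := by
  have hYZ := leviCivita_spec hg hX hY hZ
  have hZY := leviCivita_spec hg hX hZ hY
  have hsymm : (fun y => g y (Z y) (Y y)) = fun y => g y (Y y) (Z y) :=
    funext fun y => hg.symm y _ _
  unfold koszul at hYZ hZY
  rw [hsymm, bracket_swap Z Y, map_neg, neg_apply] at hZY
  rw [hg.symm x (Y x)]
  linarith

theorem leviCivita_torsion (hg : IsMetricAt g x) (hX : DiffAt X x) (hY : DiffAt Y x) :
    bracket X Y x = leviCivita g X Y x - leviCivita g Y X x := by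
  refine sub_eq_zero.1 (hg.nondegenerate _ fun z => ?_)
  have hz : DiffAt (extendConst z) x := (smoothAt_extendConst_self z).diffAt
  have hXY := leviCivita_spec hg hX hY hz
  have hYX := leviCivita_spec hg hY hX hz
  have hsymm : (fun y => g y (Y y) (X y)) = fun y => g y (X y) (Y y) :=
    funext fun y => hg.symm y _ _
  unfold koszul at hXY hYX
  rw [hsymm, bracket_swap Y X, map_neg, neg_apply] at hYX
  simp only [extendConst_self] at hXY hYX
  simp only [map_sub, sub_apply]
  linarith

theorem leviCivita_conformal (hg : IsMetricAt g x) (hf : MDifferentiableAt 𝓘(ℝ, E) 𝓘(ℝ, ℝ) f x)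
    (hX : DiffAt X x) (hY : DiffAt Y x) (z : RT E x) :
    2 * g x (leviCivita (fun y => Real.exp (-f y) • g y) X Y x) z =
      2 * g x (leviCivita g X Y x) z - dirDeriv f x (X x) * g x (Y x) z
        - dirDeriv f x (Y x) * g x (X x) z + dirDeriv f x z * g x (X x) (Y x) := by
  have hz : DiffAt (extendConst z) x := (smoothAt_extendConst_self z).diffAt
  have hspec := leviCivita_spec hg hX hY hz
  have hspec' := leviCivita_spec (hg.conformal hf) hX hY hz
  have hdir : ∀ V W : VField E M, DiffAt V x → DiffAt W x → ∀ u : RT E x,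
      dirDeriv (fun y => (Real.exp (-f y) • g y) (V y) (W y)) x u =
        Real.exp (-f x) * dirDeriv (fun y => g y (V y) (W y)) x u
          + g x (V x) (W x) * (-Real.exp (-f x) * dirDeriv f x u) := by
    intro V W hV hW u
    rw [← dirDeriv_exp_neg hf, ← dirDeriv_mul (mdifferentiableAt_exp_neg hf) (hg.diff V W hV hW)]
    rfl
  unfold koszul at hspec hspec'
  rw [hdir Y _ hY hz, hdir X _ hX hz, hdir X Y hX hY] at hspec'
  simp only [smul_apply, smul_eq_mul, extendConst_self] at hspec hspec'
  refine mul_left_cancel₀ (Real.exp_pos (-f x)).ne' ?_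
  linear_combination hspec' - Real.exp (-f x) * hspec

end LeviCivita

section LocallyConformalKahler

variable {g : BilinField E M} {ν : ℕ} {x : M} {U U' : Set M} {f f' : M → ℝ}

theorem IsIndefHermitian.isMetricAt (hg : IsIndefHermitian g ν) (x : M) : IsMetricAt g x where
  diff _ _ hX hY := hg.smooth.mdifferentiableAt_apply hX hY
  symm := hg.symm
  nondegenerate := hg.nondegenerate x

theorem IsIndefHermitian.cxJ_left (hg : IsIndefHermitian g ν) (v w : RT E x) :
    g x (cxJ x v) w = -g x v (cxJ x w) := by
  have h := hg.hermitian x v (cxJ x w)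
  rw [cxJ_cxJ, map_neg] at h
  linarith

theorem IsIndefHermitian.cxJ_self (hg : IsIndefHermitian g ν) (v : RT E x) :
    g x (cxJ x v) v = 0 := by
  have h := hg.cxJ_left v v
  rw [hg.symm x v] at h
  linarith

theorem IsLocalConformalFactor.mdifferentiableAt (hf : IsLocalConformalFactor g U f)
    (hx : x ∈ U) : MDifferentiableAt 𝓘(ℝ, E) 𝓘(ℝ, ℝ) f x :=
  (hf.2.1.contMDiffAt (hf.1.mem_nhds hx)).mdifferentiableAt (by simp)

variable [FiniteDimensional ℂ E]

theorem IsIndefHermitian.two_le_finrank (hg : IsIndefHermitian g ν) {v : RT E x} (hv : v ≠ 0)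
    (hvv : g x v v = 0) : 2 ≤ Module.finrank ℂ E := by
  by_contra! hlt
  have hone : Module.finrank ℂ (RT E x) = 1 :=
    le_antisymm (Nat.le_of_lt_succ hlt) (Module.finrank_pos_iff_exists_ne_zero.2 ⟨v, hv⟩)
  refine hv (hg.nondegenerate x v fun w => ?_)
  obtain ⟨c, rfl⟩ := exists_smul_eq_of_finrank_eq_one hone hv w
  rw [complex_smul_eq_re_smul_add_im_smul_cxJ, map_add, map_smul, map_smul, hvv,
    hg.symm, hg.cxJ_self, smul_zero, smul_zero, add_zero]

theorem leviCivita_cxJ (hg : IsIndefHermitian g ν) (hf : IsLocalConformalFactor g U f)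
    (hx : x ∈ U) {X Y : VField E M} (hX : SmoothAt X x) (hY : SmoothAt Y x) (z : RT E x) :
    2 * g x (leviCivita g X (fun y => cxJ y (Y y)) x) z
        + 2 * g x (leviCivita g X Y x) (cxJ x z) =
      dirDeriv f x (cxJ x (Y x)) * g x (X x) z - dirDeriv f x z * g x (X x) (cxJ x (Y x))
        + dirDeriv f x (Y x) * g x (X x) (cxJ x z)
        - dirDeriv f x (cxJ x z) * g x (X x) (Y x) := by
  have hdf := hf.mdifferentiableAt hx
  have hY' := leviCivita_conformal (hg.isMetricAt x) hdf hX.diffAt hY.diffAt (cxJ x z)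
  have hJY := leviCivita_conformal (hg.isMetricAt x) hdf hX.diffAt hY.cxJ.diffAt z
  rw [hf.2.2 x hx X Y hX hY, hg.cxJ_left, hg.cxJ_left] at hJY
  linarith

theorem dirDeriv_conformalFactor_unique (hn : 2 ≤ Module.finrank ℂ E) (hg : IsIndefHermitian g ν)
    (hf : IsLocalConformalFactor g U f) (hf' : IsLocalConformalFactor g U' f') (hx : x ∈ U)
    (hx' : x ∈ U') (v : RT E x) : dirDeriv f x v = dirDeriv f' x v := by
  let α : RT E x → ℝ := fun u => dirDeriv f x u - dirDeriv f' x u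
  let β : RT E x → ℂ := fun u => ⟨α (cxJ x u), α u⟩
  have hβ : ∀ y z, β y • z = β z • y := by
    refine fun y z => sub_eq_zero.1 (hg.nondegenerate x _ fun w => ?_)
    have h := leviCivita_cxJ hg hf hx (smoothAt_extendConst_self w) (smoothAt_extendConst_self y) z
    have h' := leviCivita_cxJ hg hf' hx' (smoothAt_extendConst_self w)
      (smoothAt_extendConst_self y) z
    simp only [extendConst_self] at h h'
    rw [hg.symm, complex_smul_eq_re_smul_add_im_smul_cxJ, complex_smul_eq_re_smul_add_im_smul_cxJ]
    simp only [map_add, map_sub, map_smul, smul_eq_mul, α, β]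
    linarith
  exact sub_eq_zero.1 congr(Complex.im $(eq_zero_of_smul_eq_smul hn hβ v))

theorem leeForm_eq_dirDeriv (hn : 2 ≤ Module.finrank ℂ E) (hg : IsIndefHermitian g ν)
    (hf : IsLocalConformalFactor g U f) (hx : x ∈ U) (v : RT E x) :
    leeForm g x v = dirDeriv f x v := by
  have hex : ∃ (f : M → ℝ) (U : Set M), x ∈ U ∧ IsLocalConformalFactor g U f := ⟨f, U, hx, hf⟩
  obtain ⟨U', hx', hf'⟩ := hex.choose_spec
  have hlee : leeForm g x = mvfderiv 𝓘(ℝ, E) hex.choose x := dif_pos hex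
  rw [← dirDeriv_conformalFactor_unique hn hg hf' hf hx' hx, hlee, dirDeriv_eq_mvfderiv]

theorem exists_leeForm_eq_dirDeriv (hn : 2 ≤ Module.finrank ℂ E) (hg : IsIndefHermitian g ν)
    (hlck : IsLCK g) (x : M) : ∃ (U : Set M) (f : M → ℝ), x ∈ U ∧ IsOpen U ∧
      ContMDiffOn 𝓘(ℝ, E) 𝓘(ℝ, ℝ) ∞ f U ∧
        ∀ y ∈ U, ∀ v : RT E y, leeForm g y v = dirDeriv f y v := by
  obtain ⟨U, f, hx, hf⟩ := hlck x
  exact ⟨U, f, hx, hf.1, hf.2.1, fun y hy v => leeForm_eq_dirDeriv hn hg hf hy v⟩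

theorem leviCivita_cxJ_leeForm (hn : 2 ≤ Module.finrank ℂ E) (hg : IsIndefHermitian g ν)
    (hlck : IsLCK g) {X Y : VField E M} (hX : SmoothAt X x) (hY : SmoothAt Y x) (z : RT E x) :
    2 * g x (leviCivita g X (fun y => cxJ y (Y y)) x) z
        + 2 * g x (leviCivita g X Y x) (cxJ x z) =
      leeForm g x (cxJ x (Y x)) * g x (X x) z - leeForm g x z * g x (X x) (cxJ x (Y x))
        + leeForm g x (Y x) * g x (X x) (cxJ x z)
        - leeForm g x (cxJ x z) * g x (X x) (Y x) := by
  obtain ⟨U, f, hxU, hf⟩ := hlck x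
  simp only [leeForm_eq_dirDeriv hn hg hf hxU]
  exact leviCivita_cxJ hg hf hxU hX hY z

theorem apply_leeField (hg : IsIndefHermitian g ν) (v : RT E x) :
    g x v (leeField g x) = leeForm g x v := by
  have hex : ∃ b : RT E x, ∀ v : RT E x, g x v b = leeForm g x v := by
    obtain ⟨b, hb⟩ := exists_representative (hg.nondegenerate x) (leeForm g x).toLinearMap
    exact ⟨b, fun v => by rw [hg.symm, hb]; rfl⟩
  unfold leeField
  rw [dif_pos hex]
  exact hex.choose_spec v

end LocallyConformalKahler

end Metric

section Lee

variable [IsManifold 𝓘(ℂ, E) ω M]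

section LocalCoefficients

variable {g : BilinField E M} {x y : M}

theorem SmoothBilin.exists_coord (hg : SmoothBilin g) (x : M) :
    ∃ b : M → E →L[ℝ] E →L[ℝ] ℝ, ContMDiffAt 𝓘(ℝ, E) 𝓘(ℝ, E →L[ℝ] E →L[ℝ] ℝ) ∞ b x ∧
      ∀ y ∈ (chartAt E x).source, ∀ v w : RT E y, b y (coord x y v) (coord x y w) = g y v w := by
  have h := hg.contMDiffAt (x := x)
  rw [Bundle.contMDiffAt_section] at h
  refine ⟨_, h, fun y hy v w => ?_⟩
  have hbase : y ∈ (trivializationAt E (TangentSpace 𝓘(ℝ, E)) x).baseSet := hy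
  have hsymm : ∀ u : RT E y,
      (trivializationAt E (TangentSpace 𝓘(ℝ, E)) x).symm y (coord x y u) = u := fun u => by
    rw [coord_eq_trivializationAt hy]
    exact Bundle.Trivialization.symm_apply_apply_mk _ hbase u
  have hbase' : y ∈ (trivializationAt (E →L[ℝ] ℝ) (fun y : M => RT E y →L[ℝ] ℝ) x).baseSet := by
    simpa using hy
  rw [hom_trivializationAt_apply, ContinuousLinearMap.inCoordinates,
    ContinuousLinearMap.comp_apply, ContinuousLinearMap.comp_apply,
    Bundle.Trivialization.symmL_apply _ hbase, hsymm,
    Bundle.Trivialization.continuousLinearMapAt_apply, Bundle.Trivialization.linearMapAt_apply,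
    if_pos hbase', hom_trivializationAt_apply, ContinuousLinearMap.inCoordinates,
    ContinuousLinearMap.comp_apply, ContinuousLinearMap.comp_apply,
    Bundle.Trivialization.symmL_apply _ hbase, hsymm]
  simp

theorem coord_eq_mfderiv_chartAt (hy : y ∈ (chartAt E x).source) :
    coord x y = mfderiv 𝓘(ℝ, E) 𝓘(ℝ, E) (chartAt E x) y :=
  TangentBundle.continuousLinearMapAt_trivializationAt hy

theorem dirDeriv_eq_fderiv {f : M → ℝ} (hy : y ∈ (chartAt E x).source)
    (hf : MDifferentiableAt 𝓘(ℝ, E) 𝓘(ℝ, ℝ) f y) (v : RT E y) :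
    dirDeriv f y v = fderiv ℝ (f ∘ (chartAt E x).symm) (chartAt E x y) (coord x y v) := by
  have hchart : MDifferentiableAt 𝓘(ℝ, E) 𝓘(ℝ, E) (chartAt E x) y :=
    mdifferentiableAt_atlas (chart_mem_atlas E x) hy
  have hfsymm : MDifferentiableAt 𝓘(ℝ, E) 𝓘(ℝ, ℝ) (f ∘ (chartAt E x).symm) (chartAt E x y) :=
    ((mdifferentiableAt_iff_differentiableAt_comp_chart_symm hy).1 hf).mdifferentiableAt
  have hcomp : f =ᶠ[𝓝 y] (f ∘ (chartAt E x).symm) ∘ chartAt E x := by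
    filter_upwards [(chartAt E x).open_source.mem_nhds hy] with z hz
    simp only [Function.comp_apply, (chartAt E x).left_inv hz]
  have hchain : mfderiv 𝓘(ℝ, E) 𝓘(ℝ, ℝ) ((f ∘ (chartAt E x).symm) ∘ chartAt E x) y = _ :=
    mfderiv_comp y hfsymm hchart
  rw [dirDeriv_congr hcomp, dirDeriv, hchain, mfderiv_eq_fderiv, coord_eq_mfderiv_chartAt hy]
  rfl

theorem exists_dirDeriv_coord {f : M → ℝ} (hf : ContMDiffAt 𝓘(ℝ, E) 𝓘(ℝ, ℝ) ∞ f x) :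
    ∃ a : M → E →L[ℝ] ℝ, ContMDiffAt 𝓘(ℝ, E) 𝓘(ℝ, E →L[ℝ] ℝ) ∞ a x ∧
      ∀ᶠ y in 𝓝 x, ∀ v : RT E y, dirDeriv f y v = a y (coord x y v) := by
  have hx := mem_chart_source E x
  have hchart : ContMDiffAt 𝓘(ℝ, E) 𝓘(ℝ, E) ∞ (chartAt E x) x :=
    (contMDiffOn_chart (I := 𝓘(ℝ, E)) (n := ∞) (x := x)).contMDiffAt
      ((chartAt E x).open_source.mem_nhds hx)
  have hfderiv : ContDiffAt ℝ ∞ (fderiv ℝ (f ∘ (chartAt E x).symm)) (chartAt E x x) :=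
    ((contMDiffAt_iff_contDiffAt_comp_chart_symm hx).1 hf).fderiv_right (by simp)
  refine ⟨fun y => fderiv ℝ (f ∘ (chartAt E x).symm) (chartAt E x y),
    hfderiv.contMDiffAt.comp x hchart, ?_⟩
  have hnhds := (contMDiffAt_iff_contMDiffAt_nhds (by simp)).1
    (hf.of_le (show (1 : WithTop ℕ∞) ≤ ∞ by simp))
  filter_upwards [(chartAt E x).open_source.mem_nhds hx, hnhds] with y hy hfy v
  exact dirDeriv_eq_fderiv hy (hfy.mdifferentiableAt one_ne_zero) v

variable [FiniteDimensional ℂ E]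

theorem SmoothBilin.smoothAt_of_forall_apply_eq (hg : SmoothBilin g)
    (hx : ∀ v : RT E x, (∀ w : RT E x, g x v w = 0) → v = 0) {a : M → E →L[ℝ] ℝ}
    (ha : ContMDiffAt 𝓘(ℝ, E) 𝓘(ℝ, E →L[ℝ] ℝ) ∞ a x) {X : VField E M}
    (hX : ∀ᶠ y in 𝓝 x, ∀ v : RT E y, g y (X y) v = a y (coord x y v)) : SmoothAt X x := by
  obtain ⟨b, hb, hbg⟩ := hg.exists_coord x
  have hinj : Function.Injective (b x) := by
    rw [injective_iff_map_eq_zero]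
    intro u hu
    obtain ⟨v, rfl⟩ := (coord_bijective (mem_chart_source E x)).2 u
    rw [hx v fun w => by rw [← hbg x (mem_chart_source E x), hu, zero_apply], map_zero]
  have hinvx := isInvertible_of_injective finrank_continuousDual.symm hinj
  have hinv : ∀ᶠ y in 𝓝 x, (b y).IsInvertible :=
    hb.continuousAt.eventually (eventually_isInvertible hinvx)
  rw [smoothAt_iff_coord (mem_chart_source E x)]
  have hsolve := (hinvx.contDiffAt_map_inverse.contMDiffAt.comp x hb).clm_apply ha
  refine hsolve.congr_of_eventuallyEq ?_
  filter_upwards [hX, hinv, (chartAt E x).open_source.mem_nhds (mem_chart_source E x)]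
    with y hXy hby hy
  refine Eq.symm (hby.inverse_apply_eq.2 (ContinuousLinearMap.ext fun u => ?_))
  obtain ⟨v, rfl⟩ := (coord_bijective hy).2 u
  rw [hbg y hy, hXy]

end LocalCoefficients

section LeeForm

variable [FiniteDimensional ℂ E] {g : BilinField E M} {ν : ℕ} {x : M}

theorem exists_leeForm_coord (hn : 2 ≤ Module.finrank ℂ E) (hg : IsIndefHermitian g ν)
    (hlck : IsLCK g) (x : M) :
    ∃ a : M → E →L[ℝ] ℝ, ContMDiffAt 𝓘(ℝ, E) 𝓘(ℝ, E →L[ℝ] ℝ) ∞ a x ∧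
      ∀ᶠ y in 𝓝 x, ∀ v : RT E y, leeForm g y v = a y (coord x y v) := by
  obtain ⟨U, f, hxU, hU, hf, hlee⟩ := exists_leeForm_eq_dirDeriv hn hg hlck x
  obtain ⟨a, ha, hfa⟩ := exists_dirDeriv_coord (hf.contMDiffAt (hU.mem_nhds hxU))
  refine ⟨a, ha, ?_⟩
  filter_upwards [hfa, hU.mem_nhds hxU] with y hy hyU v using (hlee y hyU v).trans (hy v)

theorem contMDiffAt_leeForm_apply (hn : 2 ≤ Module.finrank ℂ E) (hg : IsIndefHermitian g ν)
    (hlck : IsLCK g) {X : VField E M} (hX : SmoothAt X x) :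
    ContMDiffAt 𝓘(ℝ, E) 𝓘(ℝ, ℝ) ∞ (fun y => leeForm g y (X y)) x := by
  obtain ⟨a, ha, hlee⟩ := exists_leeForm_coord hn hg hlck x
  rw [smoothAt_iff_coord (mem_chart_source E x)] at hX
  exact (ha.clm_apply hX).congr_of_eventuallyEq (hlee.mono fun y hy => hy _)

theorem smoothAt_leeField (hn : 2 ≤ Module.finrank ℂ E) (hg : IsIndefHermitian g ν)
    (hlck : IsLCK g) (x : M) : SmoothAt (leeField g) x := by
  obtain ⟨a, ha, hlee⟩ := exists_leeForm_coord hn hg hlck x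
  exact hg.smooth.smoothAt_of_forall_apply_eq (hg.nondegenerate x) ha
    (hlee.mono fun y hy v => by rw [hg.symm, apply_leeField hg, hy])

end LeeForm

end Lee

section LeviFlat

section Involutive

variable {D : Distribution E M} {x : M}

theorem mem_leviDist_of_mem_T10 {v : RT E x × RT E x} (hv : v ∈ T10 D x) :
    v.1 ∈ leviDist D x ∧ v.2 ∈ leviDist D x := by
  obtain ⟨h1, h2, hJ1, hJ2⟩ := hv
  refine ⟨⟨h1, ?_⟩, ⟨h2, ?_⟩⟩
  · change cxJ x v.1 ∈ D x
    rw [hJ1]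
    exact neg_mem h2
  · change cxJ x v.2 ∈ D x
    rw [hJ2]
    exact h1

variable [IsManifold 𝓘(ℂ, E) ω M]

/-- Involutivity at the point `x`, for local smooth sections around `x`. -/
def IsInvolutiveAt (D : Distribution E M) (x : M) : Prop :=
  ∀ X Y : VField E M, SmoothAt X x → SmoothAt Y x →
    (∀ᶠ y in 𝓝 x, X y ∈ D y) → (∀ᶠ y in 𝓝 x, Y y ∈ D y) → bracket X Y x ∈ D x

theorem isInvolutiveAt_of_leviCivita_mem [FiniteDimensional ℂ E] {g : BilinField E M}
    (hg : IsMetricAt g x)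
    (h : ∀ V W : VField E M, SmoothAt V x → SmoothAt W x → (∀ᶠ y in 𝓝 x, W y ∈ D y) →
      leviCivita g V W x ∈ D x) : IsInvolutiveAt D x := by
  intro X Y hX hY hXD hYD
  rw [leviCivita_torsion hg hX.diffAt hY.diffAt]
  exact sub_mem (h X Y hX hY hYD) (h Y X hY hX hXD)

theorem leviForm_eq_zero_of_isInvolutiveAt (hD : IsInvolutiveAt (leviDist D) x) {V W : CxField E M}
    (hV : IsT10SectionAt D V x) (hW : IsT10SectionAt D W x) : leviForm D V W x = 0 := by
  obtain ⟨hVre, hVim, hVmem⟩ := hV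
  obtain ⟨hWre, hWim, hWmem⟩ := hW
  have hVre' := hVmem.mono fun y hy => (mem_leviDist_of_mem_T10 hy).1
  have hVim' := hVmem.mono fun y hy => (mem_leviDist_of_mem_T10 hy).2
  have hWre' := hWmem.mono fun y hy => (mem_leviDist_of_mem_T10 hy).1
  have hWim' := hWmem.mono fun y hy => neg_mem (mem_leviDist_of_mem_T10 hy).2
  refine Prod.ext ((Submodule.Quotient.mk_eq_zero _).2 (neg_mem (add_mem ?_ ?_)))
    ((Submodule.Quotient.mk_eq_zero _).2 (sub_mem ?_ ?_))
  · exact hD _ _ hVre hWim.neg hVre' hWim'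
  · exact hD _ _ hVim hWre hVim' hWre'
  · exact hD _ _ hVre hWre hVre' hWre'
  · exact hD _ _ hVim hWim.neg hVim' hWim'

end Involutive

/-- The standing assumption: an indefinite Hermitian locally conformal Kähler metric whose Lee form
is parallel and whose Lee field is lightlike. -/
structure IsLightlikeParallelLCK [IsManifold 𝓘(ℂ, E) ω M] (g : BilinField E M) (ν : ℕ) :
    Prop where
  hermitian : IsIndefHermitian g ν
  lck : IsLCK g
  parallel : IsParallelForm g (leeForm g)
  lightlike : IsLightlike g (leeField g)

variable [IsManifold 𝓘(ℂ, E) ω M]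

theorem mem_leviDist_firstFoliation {g : BilinField E M} {x : M} {v : RT E x} :
    v ∈ leviDist (firstFoliation g) x ↔ leeForm g x v = 0 ∧ leeForm g x (cxJ x v) = 0 :=
  Iff.rfl

theorem mem_secondFoliation {g : BilinField E M} {x : M} {v : RT E x} :
    v ∈ secondFoliation g x ↔ ∃ c : ℂ, c • leeField g x = v := by
  simp only [secondFoliation, Submodule.mem_span_pair, complex_smul_eq_re_smul_add_im_smul_cxJ]
  constructor
  · rintro ⟨a, b, rfl⟩
    exact ⟨⟨b, -a⟩, by rw [antiLeeField]; module⟩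
  · rintro ⟨c, rfl⟩
    exact ⟨-c.im, c.re, by rw [antiLeeField]; module⟩

theorem leviCivita_mem_firstFoliation {g : BilinField E M} {x : M} {V W : VField E M}
    (hg : IsParallelForm g (leeForm g)) (hV : SmoothAt V x) (hW : SmoothAt W x)
    (hWD : ∀ᶠ y in 𝓝 x, W y ∈ firstFoliation g y) : leviCivita g V W x ∈ firstFoliation g x :=
  (hg x V W hV hW).symm.trans (dirDeriv_eq_zero hWD _)

theorem leeZ_ne_zero {g : BilinField E M} (hg : IsLightlike g (leeField g)) (x : M) :
    leeZ g x ≠ 0 :=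
  fun h0 => (hg x).1 (congrArg Prod.fst h0)

namespace IsLightlikeParallelLCK

variable [FiniteDimensional ℂ E] {g : BilinField E M} {ν : ℕ} {x : M}
  (h : IsLightlikeParallelLCK g ν)

include h

theorem two_le_finrank (x : M) : 2 ≤ Module.finrank ℂ E :=
  h.hermitian.two_le_finrank (h.lightlike x).1 (h.lightlike x).2

theorem smoothAt_leeField (x : M) : SmoothAt (leeField g) x :=
  IndefLCK.smoothAt_leeField (h.two_le_finrank x) h.hermitian h.lck x

theorem leeForm_leeField (x : M) : leeForm g x (leeField g x) = 0 := by
  rw [← apply_leeField h.hermitian]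
  exact (h.lightlike x).2

theorem leeForm_cxJ_leeField (x : M) : leeForm g x (cxJ x (leeField g x)) = 0 := by
  rw [← apply_leeField h.hermitian]
  exact h.hermitian.cxJ_self _

theorem apply_cxJ_leeField (v : RT E x) :
    g x v (cxJ x (leeField g x)) = -leeForm g x (cxJ x v) := by
  rw [← apply_leeField h.hermitian, h.hermitian.cxJ_left, neg_neg]

theorem leviCivita_leeField {X : VField E M} (hX : SmoothAt X x) :
    leviCivita g X (leeField g) x = 0 := by
  refine h.hermitian.nondegenerate x _ fun z => ?_
  have hmetric := leviCivita_metric (h.hermitian.isMetricAt x) hX.diffAt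
    (h.smoothAt_leeField x).diffAt (smoothAt_extendConst_self z).diffAt
  have hparallel := h.parallel x X (extendConst z) hX (smoothAt_extendConst_self z)
  simp only [h.hermitian.symm _ (leeField g _), apply_leeField h.hermitian] at hmetric
  rw [hparallel, extendConst_self] at hmetric
  linarith

theorem leviCivita_cxJ_leeField {X : VField E M} (hX : SmoothAt X x) (z : RT E x) :
    2 * g x (leviCivita g X (fun y => cxJ y (leeField g y)) x) z =
      leeForm g x z * leeForm g x (cxJ x (X x)) - leeForm g x (cxJ x z) * leeForm g x (X x) := by
  have hJB := leviCivita_cxJ_leeForm (h.two_le_finrank x) h.hermitian h.lck hX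
    (h.smoothAt_leeField x) z
  rw [h.leviCivita_leeField hX, h.leeForm_leeField, h.leeForm_cxJ_leeField, h.apply_cxJ_leeField,
    apply_leeField h.hermitian] at hJB
  simp only [map_zero, zero_apply] at hJB
  linarith

-- `JB` is not parallel, but `∇ (JB)` takes its values in the span of `B` and `JB`, the orthogonal
-- complement of the Levi distribution.
theorem leviCivita_mem_leviDist {V W : VField E M} (hV : SmoothAt V x) (hW : SmoothAt W x)
    (hWD : ∀ᶠ y in 𝓝 x, W y ∈ leviDist (firstFoliation g) y) :
    leviCivita g V W x ∈ leviDist (firstFoliation g) x := by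
  refine ⟨leviCivita_mem_firstFoliation h.parallel hV hW (hWD.mono fun y hy => hy.1), ?_⟩
  change leeForm g x (cxJ x _) = 0
  obtain ⟨hWx, hJWx⟩ := mem_leviDist_firstFoliation.1 hWD.self_of_nhds
  have horth : ∀ᶠ y in 𝓝 x, g y (W y) (cxJ y (leeField g y)) = 0 :=
    hWD.mono fun y hy => by
      rw [h.apply_cxJ_leeField, (mem_leviDist_firstFoliation.1 hy).2, neg_zero]
  have hmetric := leviCivita_metric (h.hermitian.isMetricAt x) hV.diffAt hW.diffAt
    (h.smoothAt_leeField x).cxJ.diffAt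
  have hJB := h.leviCivita_cxJ_leeField hV (W x)
  rw [dirDeriv_eq_zero horth, h.apply_cxJ_leeField] at hmetric
  rw [hWx, hJWx, h.hermitian.symm] at hJB
  linarith

theorem isInvolutiveAt_firstFoliation (x : M) : IsInvolutiveAt (firstFoliation g) x :=
  isInvolutiveAt_of_leviCivita_mem (h.hermitian.isMetricAt x) fun _ _ =>
    leviCivita_mem_firstFoliation h.parallel

theorem isInvolutiveAt_leviDist (x : M) : IsInvolutiveAt (leviDist (firstFoliation g)) x :=
  isInvolutiveAt_of_leviCivita_mem (h.hermitian.isMetricAt x) fun _ _ =>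
    h.leviCivita_mem_leviDist

theorem leviForm_eq_zero {V W : CxField E M} (hV : IsT10SectionAt (firstFoliation g) V x)
    (hW : IsT10SectionAt (firstFoliation g) W x) : leviForm (firstFoliation g) V W x = 0 :=
  leviForm_eq_zero_of_isInvolutiveAt (h.isInvolutiveAt_leviDist x) hV hW

theorem leeZ_mem_T10 (x : M) : leeZ g x ∈ T10 (firstFoliation g) x := by
  refine ⟨h.leeForm_leeField x, ?_, ?_, ?_⟩
  · change leeForm g x (-cxJ x (leeField g x)) = 0
    rw [map_neg, h.leeForm_cxJ_leeField, neg_zero]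
  · simp [leeZ, antiLeeField]
  · simp [leeZ, antiLeeField]

theorem bracket_leeField_cxJ_leeField (x : M) :
    bracket (leeField g) (fun y => cxJ y (leeField g y)) x = 0 := by
  have hB := h.smoothAt_leeField x
  rw [leviCivita_torsion (h.hermitian.isMetricAt x) hB.diffAt hB.cxJ.diffAt,
    h.leviCivita_leeField hB.cxJ, sub_zero]
  refine h.hermitian.nondegenerate x _ fun z => ?_
  have hJB := h.leviCivita_cxJ_leeField hB z
  rw [h.leeForm_leeField, h.leeForm_cxJ_leeField] at hJB
  linarith

end IsLightlikeParallelLCK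

end LeviFlat

section Frames

theorem leaf_mono {D D' : Distribution E M} (h : ∀ x, D x ≤ D' x) (x : M) :
    leaf D x ⊆ leaf D' x := by
  have hle : TangentJoined D ≤ TangentJoined D' := fun _ _ ⟨γ, hγ, h0, h1, hD⟩ =>
    ⟨γ, hγ, h0, h1, fun t => h _ (hD t)⟩
  exact fun y hy => Relation.EqvGen.mono hle x y hy

theorem finrank_ker_form [FiniteDimensional ℂ E] {α : Form1 E M} {y : M}
    (hy : α y ≠ 0) :
    Module.finrank ℝ (LinearMap.ker (α y).toLinearMap) = Module.finrank ℝ E - 1 :=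
  Nat.eq_sub_of_add_eq <| Module.Dual.finrank_ker_add_one_of_ne_zero (f := (α y).toLinearMap)
    fun h0 => hy (ContinuousLinearMap.coe_injective h0)

section LocalFrames

variable [IsManifold 𝓘(ℂ, E) ω M] {X Y : VField E M} {x : M}

theorem exists_complex_coefficient (hX : SmoothAt X x) (hY : SmoothAt Y x) (hYx : Y x ≠ 0)
    (hXY : ∀ᶠ y in 𝓝 x, ∃ c : ℂ, c • Y y = X y) :
    ∃ c : M → ℂ, ContMDiffAt 𝓘(ℝ, E) 𝓘(ℝ, ℂ) ∞ c x ∧ X =ᶠ[𝓝 x] fun y => c y • Y y := by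
  have hx := mem_chart_source E x
  obtain ⟨φ, hφ⟩ : ∃ φ : E →L[ℂ] ℂ, φ (Y x) ≠ 0 :=
    SeparatingDual.exists_ne_zero (R := ℂ) (V := E) hYx
  let φX : M → ℂ := fun y => φ (coord x y (X y))
  let φY : M → ℂ := fun y => φ (coord x y (Y y))
  have hφX : ContMDiffAt 𝓘(ℝ, E) 𝓘(ℝ, ℂ) ∞ φX x :=
    (φ.restrictScalars ℝ).contMDiff.contMDiffAt.comp x ((smoothAt_iff_coord hx).1 hX)
  have hφY : ContMDiffAt 𝓘(ℝ, E) 𝓘(ℝ, ℂ) ∞ φY x :=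
    (φ.restrictScalars ℝ).contMDiff.contMDiffAt.comp x ((smoothAt_iff_coord hx).1 hY)
  have hφYx : φY x ≠ 0 := by rwa [← coord_self x (Y x)] at hφ
  have hdiv : ContDiffAt ℝ ∞ (fun p : ℂ × ℂ => p.1 * p.2⁻¹) (φX x, φY x) :=
    contDiffAt_fst.mul (contDiffAt_snd.inv hφYx)
  refine ⟨fun y => φX y * (φY y)⁻¹, hdiv.contMDiffAt.comp x (hφX.prodMk_space hφY), ?_⟩
  filter_upwards [hXY, (chartAt E x).open_source.mem_nhds hx,
    hφY.continuousAt.eventually_ne hφYx] with y ⟨c, hc⟩ hy hne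
  have hφc : φX y = c * φY y := by
    simp only [φX, φY, ← hc, coord_smul hy, map_smul, smul_eq_mul]
  rw [hφc, mul_inv_cancel_right₀ hne, hc]

theorem linearIndependent_extendConst {ι : Type*} {u : ι → RT E x}
    (hu : LinearIndependent ℝ u) {y : M} (hy : y ∈ (chartAt E x).source) :
    LinearIndependent ℝ fun i => extendConst (u i) y :=
  LinearIndependent.of_comp (coord x y).toLinearMap <| by
    rwa [show (coord x y).toLinearMap ∘ (fun i => extendConst (u i) y) = u from
      funext fun i => coord_extendConst (u i) hy]

variable [FiniteDimensional ℂ E]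

theorem exists_frame_ker {α : Form1 E M}
    (hα : ∀ (y : M) (X : VField E M), SmoothAt X y →
      ContMDiffAt 𝓘(ℝ, E) 𝓘(ℝ, ℝ) ∞ (fun z => α z (X z)) y)
    (hx : α x ≠ 0) : ∃ U : Set M, IsOpen U ∧ x ∈ U ∧
      ∃ X : Fin (Module.finrank ℝ E - 1) → VField E M, ∀ y ∈ U, (∀ i, SmoothAt (X i) y) ∧
        LinearIndependent ℝ (fun i => X i y) ∧
          Submodule.span ℝ (range fun i => X i y) = LinearMap.ker (α y).toLinearMap := by
  obtain ⟨c, hc⟩ := ContinuousLinearMap.exists_ne_zero hx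
  let b := Module.finBasisOfFinrankEq ℝ _ (finrank_ker_form hx)
  have hext : ∀ (v : RT E x), ∀ y ∈ (chartAt E x).source,
      ContMDiffAt 𝓘(ℝ, E) 𝓘(ℝ, ℝ) ∞ (fun z => α z (extendConst v z)) y := fun v y hy =>
    hα y _ (smoothAt_extendConst v hy)
  have hopen : IsOpen ((chartAt E x).source ∩ (fun y => α y (extendConst c y)) ⁻¹' {0}ᶜ) :=
    ContinuousOn.isOpen_inter_preimage
      (fun y hy => (hext c y hy).continuousAt.continuousWithinAt)
      (chartAt E x).open_source isOpen_compl_singleton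
  let X : Fin (Module.finrank ℝ E - 1) → VField E M := fun i y =>
    extendConst (b i : RT E x) y +
      (-(α y (extendConst (b i : RT E x) y) / α y (extendConst c y))) • extendConst c y
  refine ⟨_, hopen, ⟨mem_chart_source E x, by simpa using hc⟩, X, fun y ⟨hy, hyc⟩ => ?_⟩
  have hyc : α y (extendConst c y) ≠ 0 := hyc
  have hsmooth : ∀ i, SmoothAt (X i) y := fun i => (smoothAt_extendConst _ hy).add
    (SmoothAt.smul ((hext _ y hy).div₀ (hext c y hy) hyc).neg (smoothAt_extendConst c hy))
  have hli : LinearIndependent ℝ fun i => X i y := by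
    let β : RT E y →ₗ[ℝ] ℝ := (show E →L[ℝ] ℝ from α x).toLinearMap ∘ₗ (coord x y).toLinearMap
    have hβ : ∀ v : RT E x, β (extendConst v y) = α x v := fun v =>
      congrArg (α x) (coord_extendConst v hy)
    exact linearIndependent_add_smul
      (linearIndependent_extendConst (b.linearIndependent.map' _ (Submodule.ker_subtype _)) hy)
      (fun i => (hβ _).trans (b i).2) ((hβ c).trans_ne hc) _
  refine ⟨hsmooth, hli, Submodule.eq_of_le_of_finrank_eq (Submodule.span_le.2 ?_) ?_⟩
  · rintro _ ⟨i, rfl⟩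
    change α y (X i y) = 0
    simp only [X, map_add, map_smul, smul_eq_mul]
    field_simp
    ring
  · rw [finrank_span_eq_card hli, Fintype.card_fin,
      finrank_ker_form (fun h0 => hyc (by rw [h0]; rfl))]

end LocalFrames

end Frames

section SecondFoliation

variable [IsManifold 𝓘(ℂ, E) ω M]

theorem linearIndependent_antiLeeField_leeField {g : BilinField E M} {x : M}
    (hB : leeField g x ≠ 0) :
    LinearIndependent ℝ ![antiLeeField g x, leeField g x] := by
  rw [LinearIndependent.pair_iff]
  intro s t hst
  have hsmul : (⟨t, -s⟩ : ℂ) • leeField g x = 0 := by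
    rw [← hst, complex_smul_eq_re_smul_add_im_smul_cxJ, antiLeeField]
    module
  have hzero := (smul_eq_zero.1 hsmul).resolve_right hB
  exact ⟨neg_eq_zero.1 congr(Complex.im $hzero), congr(Complex.re $hzero)⟩

variable [FiniteDimensional ℂ E]

section ComplexLine

variable {B W X Y : VField E M} {D : Distribution E M} {x : M}

theorem bracket_mem_of_section_right (hB : SmoothAt B x) (hBx : B x ≠ 0)
    (hBD : B x ∈ D x) (hJBD : cxJ x (B x) ∈ D x)
    (hWB : bracket W B x ∈ D x) (hWJB : bracket W (fun y => cxJ y (B y)) x ∈ D x)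
    (hY : SmoothAt Y x) (hYB : ∀ᶠ y in 𝓝 x, ∃ c : ℂ, c • B y = Y y) : bracket W Y x ∈ D x := by
  obtain ⟨c, hc, hYc⟩ := exists_complex_coefficient hY hB hBx hYB
  have hre : MDifferentiableAt 𝓘(ℝ, E) 𝓘(ℝ, ℝ) (fun y => (c y).re) x :=
    (Complex.reCLM.contMDiff.contMDiffAt.comp x hc).mdifferentiableAt (by simp)
  have him : MDifferentiableAt 𝓘(ℝ, E) 𝓘(ℝ, ℝ) (fun y => (c y).im) x :=
    (Complex.imCLM.contMDiff.contMDiffAt.comp x hc).mdifferentiableAt (by simp)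
  simp only [complex_smul_eq_re_smul_add_im_smul_cxJ] at hYc
  rw [bracket_congr (Filter.EventuallyEq.refl _ W) hYc,
    bracket_add_right (hB.diffAt.smul hre) (hB.cxJ.diffAt.smul him),
    bracket_smul_right hre hB.diffAt, bracket_smul_right him hB.cxJ.diffAt]
  exact add_mem (add_mem (Submodule.smul_mem _ _ hBD) (Submodule.smul_mem _ _ hWB))
    (add_mem (Submodule.smul_mem _ _ hJBD) (Submodule.smul_mem _ _ hWJB))

theorem isInvolutiveAt_of_bracket_cxJ_eq_zero (hB : SmoothAt B x) (hBx : B x ≠ 0)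
    (hBJB : bracket B (fun y => cxJ y (B y)) x = 0)
    (hD : ∀ y, ∀ v : RT E y, v ∈ D y ↔ ∃ c : ℂ, c • B y = v) : IsInvolutiveAt D x := by
  intro X Y hX hY hXD hYD
  simp only [hD] at hXD hYD
  have hBD : B x ∈ D x := (hD x _).2 ⟨1, one_smul _ _⟩
  have hJBD : cxJ x (B x) ∈ D x := (hD x _).2 ⟨Complex.I, rfl⟩
  have hself : ∀ W : VField E M, bracket W W x = 0 := fun W =>
    congrFun VectorField.mlieBracket_self x
  have hBX : bracket B X x ∈ D x := bracket_mem_of_section_right hB hBx hBD hJBD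
    (by simp [hself]) (by simp [hBJB]) hX hXD
  have hJBX : bracket (fun y => cxJ y (B y)) X x ∈ D x :=
    bracket_mem_of_section_right hB hBx hBD hJBD
      (by simp [bracket_swap _ B, hBJB]) (by simp [hself]) hX hXD
  refine bracket_mem_of_section_right hB hBx hBD hJBD ?_ ?_ hY hYD
  · rw [bracket_swap]
    exact neg_mem hBX
  · rw [bracket_swap]
    exact neg_mem hJBX

end ComplexLine

namespace IsLightlikeParallelLCK

variable {g : BilinField E M} {ν : ℕ} (h : IsLightlikeParallelLCK g ν)

include h

theorem leeForm_ne_zero (x : M) : leeForm g x ≠ 0 := fun h0 =>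
  (h.lightlike x).1 (h.hermitian.nondegenerate x _ fun w => by
    rw [h.hermitian.symm, apply_leeField h.hermitian, h0, zero_apply])

theorem isFoliation_firstFoliation :
    IsFoliation (firstFoliation g) (Module.finrank ℝ E - 1) where
  frame x := exists_frame_ker
    (fun y _ hX => contMDiffAt_leeForm_apply (h.two_le_finrank y) h.hermitian h.lck hX)
    (h.leeForm_ne_zero x)
  involutive := h.isInvolutiveAt_firstFoliation

theorem isInvolutiveAt_secondFoliation (x : M) : IsInvolutiveAt (secondFoliation g) x :=
  isInvolutiveAt_of_bracket_cxJ_eq_zero (h.smoothAt_leeField x) (h.lightlike x).1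
    (h.bracket_leeField_cxJ_leeField x) fun _ _ => mem_secondFoliation

theorem isFoliation_secondFoliation : IsFoliation (secondFoliation g) 2 where
  frame x := by
    have hframe : ∀ y, (fun i => ![antiLeeField g, leeField g] i y) =
        ![antiLeeField g y, leeField g y] := by
      intro y
      ext i
      fin_cases i <;> rfl
    refine ⟨univ, isOpen_univ, mem_univ x, ![antiLeeField g, leeField g], fun y _ => ?_⟩
    rw [hframe, Matrix.range_cons_cons_empty]
    refine ⟨?_, linearIndependent_antiLeeField_leeField (h.lightlike y).1, rfl⟩
    rw [Fin.forall_fin_two]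
    exact ⟨(h.smoothAt_leeField y).cxJ.neg, h.smoothAt_leeField y⟩
  involutive := h.isInvolutiveAt_secondFoliation

theorem leeForm_complex_smul_leeField (x : M) (c : ℂ) :
    leeForm g x (c • leeField g x) = 0 := by
  rw [complex_smul_eq_re_smul_add_im_smul_cxJ, map_add, map_smul, map_smul, h.leeForm_leeField,
    h.leeForm_cxJ_leeField, smul_zero, smul_zero, add_zero]

theorem secondFoliation_le_leviDist (x : M) :
    secondFoliation g x ≤ leviDist (firstFoliation g) x := by
  intro v hv
  obtain ⟨c, rfl⟩ := mem_secondFoliation.1 hv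
  refine mem_leviDist_firstFoliation.2 ⟨h.leeForm_complex_smul_leeField x c, ?_⟩
  rw [cxJ_eq_I_smul, smul_smul]
  exact h.leeForm_complex_smul_leeField x _

theorem isSubfoliation : IsSubfoliation (secondFoliation g) (firstFoliation g) where
  foliation := ⟨_, h.isFoliation_secondFoliation⟩
  foliation' := ⟨_, h.isFoliation_firstFoliation⟩
  tangent_le x := (h.secondFoliation_le_leviDist x).trans inf_le_left
  leaf_subset := leaf_mono fun x => (h.secondFoliation_le_leviDist x).trans inf_le_left

theorem secondFoliation_eq_leviDist (hn : Module.finrank ℂ E = 2) (x : M) :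
    secondFoliation g x = leviDist (firstFoliation g) x := by
  refine le_antisymm (h.secondFoliation_le_leviDist x) fun v hv => ?_
  obtain ⟨hv, hJv⟩ := mem_leviDist_firstFoliation.1 hv
  have hnx : Module.finrank ℂ (RT E x) = 2 := hn
  exact mem_secondFoliation.2 (exists_smul_eq_of_ker_complex (α := (leeForm g x).toLinearMap) hnx
    (fun h0 => h.leeForm_ne_zero x (ContinuousLinearMap.coe_injective h0)) (h.lightlike x).1
    (h.leeForm_leeField x) (h.leeForm_cxJ_leeField x) hv hJv)

end IsLightlikeParallelLCK

end SecondFoliation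

section Holomorphic

variable [IsManifold 𝓘(ℂ, E) ω M]

section InChart

variable {X Y : VField E M} {x y : M} {u : E}

/-- The vector field `X` read in the preferred holomorphic chart at `x`. -/
noncomputable def inChart (x : M) (X : VField E M) : E → E :=
  (fun y => coord x y (X y)) ∘ (chartAt E x).symm

theorem inChart_apply (hy : y ∈ (chartAt E x).source) (X : VField E M) :
    inChart x X (chartAt E x y) = coord x y (X y) := by
  rw [inChart, Function.comp_apply, (chartAt E x).left_inv hy]

theorem inChart_self (x : M) (X : VField E M) : inChart x X (chartAt E x x) = X x := by
  rw [inChart_apply (mem_chart_source E x), coord_self]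

theorem inChart_cxJ (hu : u ∈ (chartAt E x).target) (X : VField E M) :
    inChart x (fun y => cxJ y (X y)) u = Complex.I • inChart x X u :=
  coord_cxJ ((chartAt E x).map_target hu) _

theorem inChart_extendConst (hu : u ∈ (chartAt E x).target) (v : RT E x) :
    inChart x (extendConst v) u = v :=
  coord_extendConst v ((chartAt E x).map_target hu)

theorem contDiffAt_inChart (hy : y ∈ (chartAt E x).source) (hX : SmoothAt X y) :
    ContDiffAt ℝ ∞ (inChart x X) (chartAt E x y) :=
  (contMDiffAt_iff_contDiffAt_comp_chart_symm hy).1 ((smoothAt_iff_coord hy).1 hX)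

theorem eventuallyEq_complex_trivializationAt (hy : y ∈ (chartAt E x).source) (X : VField E M) :
    (fun z => (trivializationAt E (TangentSpace 𝓘(ℂ, E)) x
      ⟨z, (X z : TangentSpace 𝓘(ℂ, E) z)⟩).2) =ᶠ[𝓝 y] fun z => coord x z (X z) := by
  filter_upwards [(chartAt E x).open_source.mem_nhds hy] with z hz
  rw [coord_eq_complex_trivializationAt hz]

theorem contMDiffAt_iff_inChart (hy : y ∈ (chartAt E x).source) :
    ContMDiffAt 𝓘(ℂ, E) (𝓘(ℂ, E).prod 𝓘(ℂ, E)) ω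
        (fun z => (⟨z, X z⟩ : TangentBundle 𝓘(ℂ, E) M)) y ↔
      ContDiffAt ℂ ω (inChart x X) (chartAt E x y) := by
  refine (Bundle.Trivialization.contMDiffAt_section_iff
    (e := trivializationAt E (TangentSpace 𝓘(ℂ, E)) x) hy).trans ?_
  rw [(eventuallyEq_complex_trivializationAt hy X).contMDiffAt_iff]
  exact contMDiffAt_iff_contDiffAt_comp_chart_symm hy

theorem mdifferentiableAt_iff_inChart (hy : y ∈ (chartAt E x).source) :
    MDifferentiableAt 𝓘(ℂ, E) (𝓘(ℂ, E).prod 𝓘(ℂ, E))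
        (fun z => (⟨z, X z⟩ : TangentBundle 𝓘(ℂ, E) M)) y ↔
      DifferentiableAt ℂ (inChart x X) (chartAt E x y) := by
  refine (Bundle.Trivialization.mdifferentiableAt_section_iff 𝓘(ℂ, E)
    (trivializationAt E (TangentSpace 𝓘(ℂ, E)) x)
    (fun z => (X z : TangentSpace 𝓘(ℂ, E) z)) hy).trans ?_
  rw [(eventuallyEq_complex_trivializationAt hy X).mdifferentiableAt_iff]
  exact mdifferentiableAt_iff_differentiableAt_comp_chart_symm hy

theorem mpullbackWithin_extChartAt_symm (hu : u ∈ (chartAt E x).target) (X : VField E M) :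
    VectorField.mpullbackWithin 𝓘(ℝ, E) 𝓘(ℝ, E) (extChartAt 𝓘(ℝ, E) x).symm X (range 𝓘(ℝ, E)) u =
      inChart x X u := by
  have hut : u ∈ (extChartAt 𝓘(ℝ, E) x).target := by simpa using hu
  have hsource : (extChartAt 𝓘(ℝ, E) x).symm u ∈ (chartAt E x).source := by
    simpa using (chartAt E x).map_target hu
  rw [VectorField.mpullbackWithin_apply, ContinuousLinearMap.inverse_eq
    (mfderivWithin_extChartAt_symm_comp_mfderiv_extChartAt hut)
    (mfderiv_extChartAt_comp_mfderivWithin_extChartAt_symm hut),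
    ← TangentBundle.continuousLinearMapAt_trivializationAt hsource]
  rfl

theorem bracket_eq_fderiv (X Y : VField E M) (x : M) :
    bracket X Y x = (fderiv ℝ (inChart x Y) (chartAt E x x) (X x : E)
      - fderiv ℝ (inChart x X) (chartAt E x x) (Y x : E) : E) := by
  have hpull : ∀ X : VField E M, VectorField.mpullbackWithin 𝓘(ℝ, E) 𝓘(ℝ, E)
      (extChartAt 𝓘(ℝ, E) x).symm X (range 𝓘(ℝ, E)) =ᶠ[𝓝 (chartAt E x x)] inChart x X :=
    fun X => Filter.mem_of_superset
      ((chartAt E x).open_target.mem_nhds (mem_chart_target E x))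
      fun _ hu => mpullbackWithin_extChartAt_symm hu X
  have hderiv : mfderiv 𝓘(ℝ, E) 𝓘(ℝ, E) (extChartAt 𝓘(ℝ, E) x) x = ContinuousLinearMap.id ℝ E :=
    (coord_eq_mfderiv_chartAt (mem_chart_source E x)).symm.trans
      (ContinuousLinearMap.ext (coord_self x))
  have hcongr : ∀ {L : E →L[ℝ] E} {V W : E → E} {s : Set E}, L = ContinuousLinearMap.id ℝ E →
      V =ᶠ[𝓝 (chartAt E x x)] inChart x X → W =ᶠ[𝓝 (chartAt E x x)] inChart x Y → s = univ →
      L.inverse (VectorField.lieBracketWithin ℝ V W s (chartAt E x x)) =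
        VectorField.lieBracket ℝ (inChart x X) (inChart x Y) (chartAt E x x) := by
    rintro _ V W _ rfl hV hW rfl
    rw [VectorField.lieBracketWithin_univ, hV.lieBracket_vectorField_eq hW,
      ContinuousLinearMap.inverse_id, ContinuousLinearMap.id_apply]
  have hlie : bracket X Y x =
      VectorField.lieBracket ℝ (inChart x X) (inChart x Y) (chartAt E x x) :=
    hcongr hderiv (hpull X) (hpull Y) (by simp)
  rw [hlie, VectorField.lieBracket, inChart_self, inChart_self]

theorem bracket_eq_neg_fderiv_of_inChart_const {w : E}
    (hY : ∀ u ∈ (chartAt E x).target, inChart x Y u = w) :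
    bracket X Y x = (-fderiv ℝ (inChart x X) (chartAt E x x) w : E) := by
  have hYx : (Y x : E) = w := (inChart_self x Y).symm.trans (hY _ (mem_chart_target E x))
  have hconst : inChart x Y =ᶠ[𝓝 (chartAt E x x)] fun _ => w :=
    Filter.mem_of_superset ((chartAt E x).open_target.mem_nhds (mem_chart_target E x)) hY
  rw [bracket_eq_fderiv, hconst.fderiv_eq, fderiv_fun_const, hYx]
  exact zero_sub (fderiv ℝ (inChart x X) (chartAt E x x) w)

theorem differentiableAt_inChart_of_bracket_cxJ (hX : SmoothAt X x)
    (hXJ : ∀ Y : VField E M, SmoothAt Y x →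
      bracket X (fun y => cxJ y (Y y)) x = cxJ x (bracket X Y x)) :
    DifferentiableAt ℂ (inChart x X) (chartAt E x x) := by
  refine differentiableAt_complex_of_fderiv_I_smul
    ((contDiffAt_inChart (mem_chart_source E x) hX).differentiableAt (by simp)) fun v => ?_
  have hJv := hXJ _ (smoothAt_extendConst_self (x := x) v)
  rw [bracket_eq_neg_fderiv_of_inChart_const fun u hu => inChart_extendConst hu v,
    bracket_eq_neg_fderiv_of_inChart_const (w := Complex.I • v) fun u hu =>
      (inChart_cxJ hu _).trans (congrArg (Complex.I • ·) (inChart_extendConst hu v))] at hJv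
  exact neg_inj.1 (hJv.trans (smul_neg _ _))

variable [FiniteDimensional ℂ E]

theorem contMDiffAt_complex_of_bracket_cxJ (hX : ∀ x, SmoothAt X x)
    (hXJ : ∀ (x : M) (Y : VField E M), SmoothAt Y x →
      bracket X (fun y => cxJ y (Y y)) x = cxJ x (bracket X Y x)) (x : M) :
    ContMDiffAt 𝓘(ℂ, E) (𝓘(ℂ, E).prod 𝓘(ℂ, E)) ω
      (fun y => (⟨y, X y⟩ : TangentBundle 𝓘(ℂ, E) M)) x := by
  have hdiff : DifferentiableOn ℂ (inChart x X) (chartAt E x).target := by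
    intro u hu
    have hself := differentiableAt_inChart_of_bracket_cxJ (hX ((chartAt E x).symm u)) (hXJ _)
    have hu' := (mdifferentiableAt_iff_inChart ((chartAt E x).map_target hu)).1
      ((mdifferentiableAt_iff_inChart (mem_chart_source E _)).2 hself)
    rw [(chartAt E x).right_inv hu] at hu'
    exact hu'.differentiableWithinAt
  have hsmooth : ContDiffOn ℝ ∞ (inChart x X) (chartAt E x).target := by
    intro u hu
    have hu' := contDiffAt_inChart ((chartAt E x).map_target hu) (hX ((chartAt E x).symm u))
    rw [(chartAt E x).right_inv hu] at hu'
    exact hu'.contDiffWithinAt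
  have hcomplex : ContDiffOn ℂ ∞ (inChart x X) (chartAt E x).target :=
    contDiffOn_infty.2 fun n =>
      contDiffOn_complex_of_real (chartAt E x).open_target n hsmooth hdiff
  exact (contMDiffAt_iff_inChart (mem_chart_source E x)).2
    (analyticAt_of_contDiffOn (chartAt E x).open_target hcomplex
      (mem_chart_target E x)).contDiffAt

end InChart

namespace IsLightlikeParallelLCK

variable [FiniteDimensional ℂ E] {g : BilinField E M} {ν : ℕ} (h : IsLightlikeParallelLCK g ν)

include h

theorem bracket_leeField_cxJ {x : M} {X : VField E M} (hX : SmoothAt X x) :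
    bracket (leeField g) (fun y => cxJ y (X y)) x = cxJ x (bracket (leeField g) X x) := by
  have hB := h.smoothAt_leeField x
  have hmetric := h.hermitian.isMetricAt x
  rw [leviCivita_torsion hmetric hB.diffAt hX.cxJ.diffAt,
    leviCivita_torsion hmetric hB.diffAt hX.diffAt, h.leviCivita_leeField hX.cxJ,
    h.leviCivita_leeField hX, sub_zero, sub_zero, ← sub_eq_zero]
  refine h.hermitian.nondegenerate x _ fun z => ?_
  have hleft : ∀ z, g x (leeField g x) z = leeForm g x z := fun z => by
    rw [h.hermitian.symm, apply_leeField h.hermitian]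
  have hJX := leviCivita_cxJ_leeForm (h.two_le_finrank x) h.hermitian h.lck hB hX z
  simp only [hleft] at hJX
  rw [map_sub, sub_apply, h.hermitian.cxJ_left]
  linarith

theorem contMDiffAt_complex_leeField (x : M) :
    ContMDiffAt 𝓘(ℂ, E) (𝓘(ℂ, E).prod 𝓘(ℂ, E)) ω
      (fun y => (⟨y, leeField g y⟩ : TangentBundle 𝓘(ℂ, E) M)) x :=
  contMDiffAt_complex_of_bracket_cxJ h.smoothAt_leeField (fun _ _ => h.bracket_leeField_cxJ) x

theorem isHolomorphicFoliation_secondFoliation :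
    IsHolomorphicFoliation (secondFoliation g) 1 where
  frame x := by
    refine ⟨univ, isOpen_univ, mem_univ x, fun _ y => leeField g y,
      fun _ y _ => (h.contMDiffAt_complex_leeField y).contMDiffWithinAt, fun y _ =>
      ⟨LinearIndependent.of_subsingleton (0 : Fin 1) (h.lightlike y).1, fun v => ?_⟩⟩
    change v ∈ Submodule.span ℂ (range fun _ : Fin 1 => (leeField g y : E)) ↔ _
    rw [range_const]
    exact (Submodule.mem_span_singleton (M := E)).trans mem_secondFoliation.symm
  involutive := h.isInvolutiveAt_secondFoliation

end IsLightlikeParallelLCK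

end Holomorphic

section Leaves

theorem mem_leaf_self (D : Distribution E M) (x : M) : x ∈ leaf D x := Relation.EqvGen.refl x

theorem leaf_subset_of_mem {D : Distribution E M} {x y : M} (hy : y ∈ leaf D x) :
    leaf D y ⊆ leaf D x := fun _ hz => Relation.EqvGen.trans _ _ _ hy hz

theorem tangentJoined_of_dirDeriv_eq_zero {D : Distribution E M} {f : M → ℝ} {γ : ℝ → M}
    (hγ : ContMDiff 𝓘(ℝ, ℝ) 𝓘(ℝ, E) ∞ γ)
    (hf : ∀ t, MDifferentiableAt 𝓘(ℝ, E) 𝓘(ℝ, ℝ) f (γ t))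
    (hD : ∀ t (v : RT E (γ t)), dirDeriv f (γ t) v = 0 → v ∈ D (γ t))
    (hconst : ∀ t, f (γ t) = f (γ 0)) (t : ℝ) : TangentJoined D (γ 0) (γ t) := by
  have hscale : ContMDiff 𝓘(ℝ, ℝ) 𝓘(ℝ, ℝ) ∞ fun s : ℝ => t * s :=
    (contDiff_const.mul contDiff_id).contMDiff
  refine ⟨fun s => γ (t * s), hγ.comp hscale, by simp, by simp, fun s => hD _ _ ?_⟩
  have hcomp := mfderiv_comp (I' := 𝓘(ℝ, E)) s (hf (t * s))
    ((hγ.comp hscale).mdifferentiableAt (by simp) (x := s))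
  have hfγ : f ∘ (γ ∘ fun s => t * s) = fun _ => f (γ 0) := funext fun s => hconst (t * s)
  rw [hfγ, mfderiv_const] at hcomp
  exact congr($hcomp.symm (1 : ℝ))

namespace IsLightlikeParallelLCK

variable [IsManifold 𝓘(ℂ, E) ω M] [FiniteDimensional ℂ E] {g : BilinField E M} {ν : ℕ}
  (h : IsLightlikeParallelLCK g ν)

include h

theorem exists_curve_in_leaf {x y : M} (hy : y ∈ (chartAt E x).source) :
    ∃ α : E →L[ℝ] ℝ, α ≠ 0 ∧ ∀ v, α v = 0 → ∃ c : ℝ → E, c 0 = chartAt E x y ∧ HasDerivAt c v 0 ∧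
      ∀ t, c t ∈ (chartAt E x).target ∩
        (chartAt E x).symm ⁻¹' leaf (firstFoliation g) y := by
  obtain ⟨U, f, hyU, hU, hf, hfe⟩ :=
    exists_leeForm_eq_dirDeriv (h.two_le_finrank y) h.hermitian h.lck y
  set φ := chartAt E x
  have hfU : ∀ z ∈ U, ContMDiffAt 𝓘(ℝ, E) 𝓘(ℝ, ℝ) ∞ f z := fun z hz =>
    hf.contMDiffAt (hU.mem_nhds hz)
  have hV : IsOpen (φ.target ∩ φ.symm ⁻¹' U) := φ.isOpen_inter_preimage_symm hU
  have hyV : φ y ∈ φ.target ∩ φ.symm ⁻¹' U :=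
    ⟨φ.map_source hy, by rwa [mem_preimage, φ.left_inv hy]⟩
  have hsmooth : ContDiffOn ℝ ∞ (f ∘ φ.symm) (φ.target ∩ φ.symm ⁻¹' U) := fun u ⟨hu, huU⟩ => by
    have hfu : ContDiffAt ℝ ∞ (f ∘ φ.symm) (φ (φ.symm u)) :=
      (contMDiffAt_iff_contDiffAt_comp_chart_symm (φ.map_target hu)).1 (hfU _ huU)
    rw [φ.right_inv hu] at hfu
    exact hfu.contDiffWithinAt
  have hne : fderiv ℝ (f ∘ φ.symm) (φ y) ≠ 0 := fun h0 => by
    refine h.leeForm_ne_zero y (ContinuousLinearMap.ext fun w => ?_)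
    rw [hfe y hyU, dirDeriv_eq_fderiv hy ((hfU y hyU).mdifferentiableAt (by simp)), h0]
    rfl
  refine ⟨_, hne, fun v hv => ?_⟩
  obtain ⟨c, hc, hc0, hcv, hcV⟩ := exists_curve_in_level_set hV hsmooth hyV hne hv
  have hγ : ContMDiff 𝓘(ℝ, ℝ) 𝓘(ℝ, E) ∞ fun t => φ.symm (c t) := fun t =>
    ((contMDiffOn_chart_symm (I := 𝓘(ℝ, E))).contMDiffAt
      (φ.open_target.mem_nhds (hcV t).1.1)).comp t hc.contDiffAt.contMDiffAt
  have hγ0 : φ.symm (c 0) = y := by rw [hc0, φ.left_inv hy]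
  refine ⟨c, hc0, hcv, fun t => ⟨(hcV t).1.1, Relation.EqvGen.rel _ _ (hγ0 ▸ ?_)⟩⟩
  exact tangentJoined_of_dirDeriv_eq_zero (D := firstFoliation g) hγ
    (fun t => (hfU _ (hcV t).1.2).mdifferentiableAt (by simp))
    (fun t v hv => (hfe _ (hcV t).1.2 v).trans hv) (fun t => (hcV t).2.trans (hcV 0).2.symm) t

theorem uniqueDiffOn_leaf (x y : M) :
    UniqueDiffOn ℂ ((chartAt E x).target ∩ (chartAt E x).symm ⁻¹' leaf (firstFoliation g) y) := by
  rintro u ⟨hu, huy⟩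
  obtain ⟨α, hα, hcurve⟩ := h.exists_curve_in_leaf ((chartAt E x).map_target hu)
  have hcone : ∀ v, α v = 0 → v ∈ tangentConeAt ℂ
      ((chartAt E x).target ∩ (chartAt E x).symm ⁻¹' leaf (firstFoliation g) y) u := by
    intro v hv
    obtain ⟨c, hc0, hc, hcleaf⟩ := hcurve v hv
    rw [← (chartAt E x).right_inv hu, ← hc0]
    exact mem_tangentConeAt_of_hasDerivAt hc fun t =>
      ⟨(hcleaf t).1, leaf_subset_of_mem huy (hcleaf t).2⟩
  refine ⟨?_, subset_closure ⟨hu, huy⟩⟩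
  rw [eq_top_of_ker_subset (α := α.toLinearMap)
    (fun h0 => hα (ContinuousLinearMap.coe_injective h0))
    fun v hv => Submodule.subset_span (hcone v hv)]
  exact dense_univ

end IsLightlikeParallelLCK

end Leaves

section Uniqueness

variable [IsManifold 𝓘(ℂ, E) ω M]

namespace IsHolomorphicFoliation

variable {G G' : Distribution E M} {k l : ℕ}

theorem rank_eq (hG : IsHolomorphicFoliation G k) (hG' : IsHolomorphicFoliation G' l)
    {x : M} (hx : G x = G' x) : k = l := by
  obtain ⟨U, -, hxU, X, -, hX⟩ := hG.frame x
  obtain ⟨U', -, hxU', X', -, hX'⟩ := hG'.frame x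
  have hspan : Submodule.span ℂ (range fun i => X i x) =
      Submodule.span ℂ (range fun i => X' i x) := by
    ext v
    rw [(hX x hxU).2 v, (hX' x hxU').2 v, hx]
  simpa only [finrank_span_eq_card (hX x hxU).1, finrank_span_eq_card (hX' x hxU').1,
    Fintype.card_fin] using congr(Module.finrank ℂ $hspan)

theorem exists_frame_inChart (hG : IsHolomorphicFoliation G k) (x : M) :
    ∃ F : Fin k → E → E, ∀ᶠ u in 𝓝 (chartAt E x x), (∀ i, ContDiffAt ℂ ω (F i) u) ∧
      LinearIndependent ℂ (fun i => F i u) ∧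
      ∀ w : RT E ((chartAt E x).symm u),
        coord x ((chartAt E x).symm u) w ∈ Submodule.span ℂ (range fun i => F i u) ↔
          w ∈ G ((chartAt E x).symm u) := by
  obtain ⟨U, hU, hxU, X, hX, hspan⟩ := hG.frame x
  have hsymm : ContinuousAt (chartAt E x).symm (chartAt E x x) :=
    (chartAt E x).symm.continuousAt (mem_chart_target E x)
  refine ⟨fun i => inChart x (X i), ?_⟩
  filter_upwards [(chartAt E x).open_target.mem_nhds (mem_chart_target E x),
    hsymm (hU.mem_nhds (by simpa using hxU))] with u hu huU
  have hy := (chartAt E x).map_target hu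
  let c : TangentSpace 𝓘(ℂ, E) ((chartAt E x).symm u) →ₗ[ℂ] E :=
    { toFun := coord x _, map_add' := map_add (coord x _), map_smul' := coord_smul hy }
  have hc : Function.Injective c := (coord_bijective hy).1
  refine ⟨fun i => ?_, (hspan _ huU).1.map' c (LinearMap.ker_eq_bot.2 hc), fun w => ?_⟩
  · have hXi := (contMDiffAt_iff_inChart hy).1 ((hX i).contMDiffAt (hU.mem_nhds huU))
    rwa [(chartAt E x).right_inv hu] at hXi
  · refine Iff.trans ?_ ((hspan _ huU).2 w)
    have hmap := Submodule.map_span c (range fun i => X i ((chartAt E x).symm u))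
    rw [← range_comp] at hmap
    exact (SetLike.ext_iff.1 hmap (c w)).symm.trans (Function.Injective.mem_set_image hc)

variable [FiniteDimensional ℂ E]

theorem exists_coincidence_map (hG : IsHolomorphicFoliation G k)
    (hG' : IsHolomorphicFoliation G' k) (x : M) :
    ∃ ψ : E → Fin k → E, ∀ᶠ u in 𝓝 (chartAt E x x), AnalyticAt ℂ ψ u ∧
      (ψ u = 0 ↔ G ((chartAt E x).symm u) = G' ((chartAt E x).symm u)) := by
  obtain ⟨F, hF⟩ := hG.exists_frame_inChart x
  obtain ⟨F', hF'⟩ := hG'.exists_frame_inChart x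
  obtain ⟨ψ, hψ⟩ := exists_contDiffAt_eq_zero_iff_mem_span (hF.mono fun u hu => hu.1)
    (hF'.mono fun u hu => hu.1) hF'.self_of_nhds.2.1
  refine ⟨ψ, ?_⟩
  filter_upwards [hF, hF', hψ, (chartAt E x).open_target.mem_nhds (mem_chart_target E x)]
    with u ⟨_, hind, hmem⟩ ⟨_, hind', hmem'⟩ ⟨hψu, hψ0⟩ hu
  refine ⟨hψu.analyticAt, hψ0.trans ⟨fun hle => ?_, fun hGG' i => ?_⟩⟩
  · have hspan := Submodule.eq_of_le_of_finrank_eq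
      (Submodule.span_le.2 (range_subset_iff.2 hle)) (by
        rw [finrank_span_eq_card hind, finrank_span_eq_card hind'])
    ext w
    rw [← hmem, ← hmem', hspan]
  · obtain ⟨w, hw⟩ := (coord_bijective ((chartAt E x).map_target hu)).2 (F i u)
    rw [← hw, hmem', ← hGG', ← hmem, hw]
    exact Submodule.subset_span (mem_range_self i)

theorem eq_of_eventually_eq [PreconnectedSpace M] (hG : IsHolomorphicFoliation G k)
    (hG' : IsHolomorphicFoliation G' k) {x : M} (hx : ∀ᶠ y in 𝓝 x, G y = G' y) : G = G' := by
  have hopen : IsOpen {z : M | ∀ᶠ y in 𝓝 z, G y = G' y} := isOpen_setOfPred_eventually_nhds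
  have hclosed : IsClosed {z : M | ∀ᶠ y in 𝓝 z, G y = G' y} := by
    refine closure_subset_iff_isClosed.1 fun z hz => ?_
    obtain ⟨ψ, hψ⟩ := hG.exists_coincidence_map hG' z
    obtain ⟨r, hr, hball⟩ := Metric.eventually_nhds_iff_ball.1 hψ
    set φ := chartAt E z
    have hN : IsOpen (φ.source ∩ φ ⁻¹' Metric.ball (φ z) r) :=
      φ.isOpen_inter_preimage Metric.isOpen_ball
    have hzN : z ∈ φ.source ∩ φ ⁻¹' Metric.ball (φ z) r :=
      ⟨mem_chart_source E z, Metric.mem_ball_self hr⟩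
    obtain ⟨y, hyN, hy⟩ := mem_closure_iff.1 hz _ hN hzN
    have hψy : ψ =ᶠ[𝓝 (φ y)] 0 := by
      have hsymm : Filter.Tendsto φ.symm (𝓝 (φ y)) (𝓝 y) := by
        simpa only [ContinuousAt, φ.left_inv hyN.1] using
          φ.symm.continuousAt (φ.map_source hyN.1)
      filter_upwards [hsymm.eventually hy, Metric.isOpen_ball.mem_nhds hyN.2] with u hu hub
      exact (hball u hub).2.2 hu
    have hψ0 : EqOn ψ 0 (Metric.ball (φ z) r) :=
      AnalyticOnNhd.eqOn_zero_of_preconnected_of_eventuallyEq_zero (fun u hu => (hball u hu).1)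
        (convex_ball (φ z) r).isPreconnected hyN.2 hψy
    refine Filter.mem_of_superset (hN.mem_nhds hzN) fun w hw => ?_
    exact φ.left_inv hw.1 ▸ (hball _ hw.2).2.1 (hψ0 hw.2)
  have huniv := IsClopen.eq_univ ⟨hclosed, hopen⟩ ⟨x, hx⟩
  exact funext fun y => (eq_univ_iff_forall.1 huniv y).self_of_nhds

end IsHolomorphicFoliation

namespace IsLightlikeParallelLCK

variable [FiniteDimensional ℂ E] {g : BilinField E M} {ν : ℕ} (h : IsLightlikeParallelLCK g ν)

include h

theorem eq_of_eqOn_leaf [PreconnectedSpace M] {G G' : Distribution E M} {k l : ℕ}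
    (hG : IsHolomorphicFoliation G k) (hG' : IsHolomorphicFoliation G' l) {x : M}
    (hL : ∀ y ∈ leaf (firstFoliation g) x, G y = G' y) : G = G' := by
  obtain rfl := hG.rank_eq hG' (hL x (mem_leaf_self _ x))
  obtain ⟨ψ, hψ⟩ := hG.exists_coincidence_map hG' x
  obtain ⟨r, hr, hball⟩ := Metric.eventually_nhds_iff_ball.1 hψ
  have hψ0 : ∀ᶠ u in 𝓝 (chartAt E x x), ψ u = 0 :=
    eventually_eq_zero_of_eqOn_uniqueDiffOn hψ.self_of_nhds.1
      ((h.uniqueDiffOn_leaf x x).inter Metric.isOpen_ball)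
      ⟨⟨mem_chart_target E x, by simpa using mem_leaf_self _ x⟩, Metric.mem_ball_self hr⟩
      fun u hu => (hball u hu.2).2.2 (hL _ hu.1.2)
  refine hG.eq_of_eventually_eq hG' (x := x) ?_
  have hφ : ContinuousAt (chartAt E x) x := (chartAt E x).continuousAt (mem_chart_source E x)
  filter_upwards [hφ.eventually (hψ.and hψ0),
    (chartAt E x).open_source.mem_nhds (mem_chart_source E x)] with y ⟨⟨_, hy⟩, hy0⟩ hys
  exact (chartAt E x).left_inv hys ▸ hy.1 hy0

end IsLightlikeParallelLCK

end Uniqueness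

end IndefLCK

open IndefLCK in
theorem proposition4_general {E : Type*} [NormedAddCommGroup E] [NormedSpace ℂ E]
    [FiniteDimensional ℂ E] {M : Type*} [TopologicalSpace M] [ChartedSpace E M]
    [IsManifold 𝓘(ℂ, E) ω M] {ν : ℕ} (g : BilinField E M) (hg : IsIndefHermitian g ν)
    (hlck : IsLCK g) (hparallel : IsParallelForm g (leeForm g))
    (hlight : IsLightlike g (leeField g)) :
    (∀ L ∈ leaves (firstFoliation g),
      IsLeviDegenerate (firstFoliation g) L ∧
      ∀ x ∈ L, leeZ g x ≠ 0 ∧ leeZ g x ∈ leviNull (firstFoliation g) x ∧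
        leeZ g x ∈ leviRadical (firstFoliation g) x) ∧
    IsSubfoliation (secondFoliation g) (firstFoliation g) ∧
    (∀ L ∈ leaves (firstFoliation g), IsLeviFlat (firstFoliation g) L) ∧
    IsHolomorphicFoliation (secondFoliation g) 1 ∧
    (Module.finrank ℂ E = 2 →
      (∀ L ∈ leaves (firstFoliation g),
        ExtendsLeviFoliation (secondFoliation g) (firstFoliation g) L) ∧
      (∀ G : Distribution E M, (∃ k, IsHolomorphicFoliation G k) →
        (∀ L ∈ leaves (firstFoliation g), ExtendsLeviFoliation G (firstFoliation g) L) →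
          G = secondFoliation g) ∧
      (PreconnectedSpace M → ∀ L ∈ leaves (firstFoliation g), ∀ G : Distribution E M,
        (∃ k, IsHolomorphicFoliation G k) → ExtendsLeviFoliation G (firstFoliation g) L →
          G = secondFoliation g)) := by
  have h : IsLightlikeParallelLCK g ν := ⟨hg, hlck, hparallel, hlight⟩
  have hrad : ∀ x, leeZ g x ∈ leviRadical (firstFoliation g) x := fun x =>
    ⟨h.leeZ_mem_T10 x, fun _ _ hV hW _ => h.leviForm_eq_zero hV hW⟩
  have hnull : ∀ x, leeZ g x ∈ leviNull (firstFoliation g) x := fun x =>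
    ⟨h.leeZ_mem_T10 x, fun _ hV _ => h.leviForm_eq_zero hV hV⟩
  have hZ : ∀ x, leeZ g x ≠ 0 := leeZ_ne_zero hlight
  refine ⟨fun L _ => ⟨fun x _ => ⟨_, hrad x, hZ x⟩, fun x _ => ⟨hZ x, hnull x, hrad x⟩⟩,
    h.isSubfoliation, fun L _ x _ _ _ hV hW => h.leviForm_eq_zero hV hW,
    h.isHolomorphicFoliation_secondFoliation, fun hdim => ?_⟩
  have hP := h.secondFoliation_eq_leviDist hdim
  refine ⟨fun L _ x _ => hP x, fun G _ hG => funext fun x => ?_, ?_⟩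
  · exact (hG _ ⟨x, rfl⟩ x (mem_leaf_self _ x)).trans (hP x).symm
  · rintro _ _ ⟨x, rfl⟩ G ⟨k, hG⟩ hL
    exact h.eq_of_eqOn_leaf hG h.isHolomorphicFoliation_secondFoliation fun y hy =>
      (hL y hy).trans (hP y).symm

open IndefLCK in
theorem proposition4 {E : Type*} [NormedAddCommGroup E] [NormedSpace ℂ E] [FiniteDimensional ℂ E]
    {M : Type*} [TopologicalSpace M] [T2Space M] [ChartedSpace E M] [IsManifold 𝓘(ℂ, E) ω M]
    (n s : ℕ) (hn : Module.finrank ℂ E = n) (hs : 0 < s) (hsn : s < n)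
    (g : BilinField E M) (hg : IsIndefHermitian g (2 * s)) (hlck : IsLCK g)
    (hparallel : IsParallelForm g (leeForm g)) (hlight : IsLightlike g (leeField g)) :
    (∀ L ∈ leaves (firstFoliation g),
      IsLeviDegenerate (firstFoliation g) L ∧
      ∀ x ∈ L, leeZ g x ≠ 0 ∧ leeZ g x ∈ leviNull (firstFoliation g) x ∧
        leeZ g x ∈ leviRadical (firstFoliation g) x) ∧
    IsSubfoliation (secondFoliation g) (firstFoliation g) ∧
    (n = 2 →
      (∀ L ∈ leaves (firstFoliation g), IsLeviFlat (firstFoliation g) L) ∧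
      IsHolomorphicFoliation (secondFoliation g) 1 ∧
      (∀ L ∈ leaves (firstFoliation g),
        ExtendsLeviFoliation (secondFoliation g) (firstFoliation g) L) ∧
      (∀ G : Distribution E M, (∃ k, IsHolomorphicFoliation G k) →
        (∀ L ∈ leaves (firstFoliation g), ExtendsLeviFoliation G (firstFoliation g) L) →
          G = secondFoliation g) ∧
      (PreconnectedSpace M → ∀ L ∈ leaves (firstFoliation g), ∀ G : Distribution E M,
        (∃ k, IsHolomorphicFoliation G k) → ExtendsLeviFoliation G (firstFoliation g) L →
          G = secondFoliation g)) := by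
  obtain ⟨hdeg, hsub, hflat, hhol, hext⟩ := proposition4_general g hg hlck hparallel hlight
  exact ⟨hdeg, hsub, fun hn2 => ⟨hflat, hhol, hext (hn.trans hn2)⟩⟩
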